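/- Let $p$ be a prime and let $n,m\ge 1$ be integers. Let $G_{m,p}=SU(p)^m/\Delta(\mathbb Z/p)$, where $\Delta(\mathbb Z/p)\subset Z(SU(p)^m)=(\mathbb Z/p)^m$ is the diagonal subgroup of tuples $(\zeta I,\dots,\zeta I)$ with $\zeta^p=1$. Let $\mathrm{Hom}(\mathbb Z^n,G_{m,p})$ be the space of commuting $n$-tuples in $G_{m,p}$, a subspace of $G_{m,p}^n$, and let $\mathrm{Rep}(\mathbb Z^n,G_{m,p})=\mathrm{Hom}(\mathbb Z^n,G_{m,p})/G_{m,p}$ be its quotient under simultaneous conjugation, with the quotient topology. Let $T\subset G_{m,p}$ be the standard maximal torus, consisting of the classes of $m$-tuples of diagonal matrices; the group $(\Sigma_p)^m$ acts on $T$ (as the Weyl group) by permuting the diagonal entries in each of the $m$ factors, and acts diagonally on $T^n$. Put $$N(n,m,p)=\frac{p^{(m-1)(n-2)}(p^n-1)(p^{n-1}-1)}{p^2-1}+1 .$$ Then: 1. $T$ is isomorphic, as a topological group, to $(\mathbb S^1)^{(p-1)m}$. 2. $\mathrm{Rep}(\mathbb Z^n,G_{m,p})$ has exactly $N(n,m,p)$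 path components. 3. There is a homeomorphism $$\mathrm{Rep}(\mathbb Z^n,G_{m,p})\cong T^n/(\Sigma_p)^m\ \sqcup\ X_{n,m,p},$$ where $T^n/(\Sigma_p)^m\cong(\mathbb S^1)^{(p-1)mn}/(\Sigma_p)^m$ and $X_{n,m,p}$ is a finite discrete set with $N(n,m,p)-1$ points; on the first summand its inverse is induced by the inclusion $T^n\subset\mathrm{Hom}(\mathbb Z^n,G_{m,p})$. 4. Every path component of $\mathrm{Hom}(\mathbb Z^n,G_{m,p})$ that does not contain $(1,\dots,1)$ is a single conjugation orbit, and its image in $\mathrm{Rep}(\mathbb Z^n,G_{m,p})$ is an isolated point. -/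

import Mathlib

/-- The special unitary group `SU(p)`, topologized as a subspace of the `p × p` complex matrices. -/
abbrev SU (p : ℕ) : Type := Matrix.specialUnitaryGroup (Fin p) ℂ

/-- `Δ(ℤ/p) ⊆ SU(p)^m`: the constant tuples `(ζ • 1, …, ζ • 1)` of scalar matrices in `SU(p)`
(so `ζ ^ p = det (ζ • 1) = 1`), i.e. the diagonal copy of `ℤ/p` in `Z(SU(p)^m) = (ℤ/p)^m`. -/
def diagCenter (m p : ℕ) : Subgroup (Fin m → SU p) where
  carrier := {A | ∃ ζ : ℂ, ∀ k, (A k : Matrix (Fin p) (Fin p) ℂ) = Matrix.scalar (Fin p) ζ}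
  one_mem' := ⟨1, fun _ => (map_one _).symm⟩
  mul_mem' := by
    rintro A B ⟨a, ha⟩ ⟨b, hb⟩
    exact ⟨a * b, fun k => by rw [Pi.mul_apply, Submonoid.coe_mul, ha, hb, map_mul]⟩
  inv_mem' := by
    rintro A ⟨a, ha⟩
    refine ⟨star a, fun k => ?_⟩
    change star (A k : Matrix (Fin p) (Fin p) ℂ) = _
    rw [ha, Matrix.scalar_apply, Matrix.scalar_apply, Matrix.star_eq_conjTranspose,
      Matrix.diagonal_conjTranspose]
    rfl

instance diagCenter_normal (m p : ℕ) : (diagCenter m p).Normal := by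
  refine ⟨?_⟩
  rintro A ⟨a, ha⟩ g
  have h : g * A = A * g := by
    funext k
    apply Subtype.ext
    rw [Pi.mul_apply, Pi.mul_apply, Submonoid.coe_mul, Submonoid.coe_mul, ha]
    exact ((Matrix.scalar_commute a (fun r => Commute.all a r) _).eq).symm
  rw [h, mul_inv_cancel_right]
  exact ⟨a, ha⟩

/-- The `m`-fold central product `G_{m,p} = SU(p)^m / Δ(ℤ/p)`, with the quotient group structure
and the quotient topology. -/
abbrev CentralProd (m p : ℕ) : Type := (Fin m → SU p) ⧸ diagCenter m p

/-- The space `Hom(ℤⁿ, G)`: the commuting `n`-tuples in `G`, as a subspace of `Gⁿ`. -/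
abbrev HomZ (n : ℕ) (G : Type) [Group G] : Type :=
  {x : Fin n → G // ∀ i j, Commute (x i) (x j)}

/-- The trivial homomorphism `(1, …, 1)`. -/
def HomZ.trivial (n : ℕ) (G : Type) [Group G] : HomZ n G :=
  ⟨fun _ => 1, fun _ _ => Commute.one_left _⟩

/-- `G` acts on `Hom(ℤⁿ, G)` by simultaneous conjugation
`g • (x₁, …, xₙ) = (g x₁ g⁻¹, …, g xₙ g⁻¹)`. -/
instance HomZ.conjAction (n : ℕ) (G : Type) [Group G] : MulAction (ConjAct G) (HomZ n G) where
  smul g x := ⟨fun i => ConjAct.ofConjAct g * x.1 i * (ConjAct.ofConjAct g)⁻¹, fun i j => by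
    have h := x.2 i j
    simpa using h.map (MulAut.conj (ConjAct.ofConjAct g))⟩
  one_smul x := by
    apply Subtype.ext
    funext i
    change ConjAct.ofConjAct (1 : ConjAct G) * x.1 i * (ConjAct.ofConjAct (1 : ConjAct G))⁻¹ = x.1 i
    simp
  mul_smul g h x := by
    apply Subtype.ext
    funext i
    change ConjAct.ofConjAct (g * h) * x.1 i * (ConjAct.ofConjAct (g * h))⁻¹ =
      ConjAct.ofConjAct g * (ConjAct.ofConjAct h * x.1 i * (ConjAct.ofConjAct h)⁻¹) *
        (ConjAct.ofConjAct g)⁻¹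
    simp [mul_assoc]

/-- The moduli space `Rep(ℤⁿ, G) = Hom(ℤⁿ, G) / G`, with the quotient topology. -/
abbrev RepZ (n : ℕ) (G : Type) [Group G] : Type :=
  Quotient (MulAction.orbitRel (ConjAct G) (HomZ n G))

/-- The standard maximal torus of `SU(p)^m`: tuples of diagonal matrices. -/
def diagTuples (m p : ℕ) : Subgroup (Fin m → SU p) where
  carrier := {A | ∀ k, (A k : Matrix (Fin p) (Fin p) ℂ).IsDiag}
  one_mem' _ := Matrix.isDiag_one
  mul_mem' {A B} hA hB k := by
    rw [Pi.mul_apply, Submonoid.coe_mul, ← (hA k).diagonal_diag, ← (hB k).diagonal_diag,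
      Matrix.diagonal_mul_diagonal]
    exact Matrix.isDiag_diagonal _
  inv_mem' {A} hA k := by
    change (star (A k : Matrix (Fin p) (Fin p) ℂ)).IsDiag
    exact (hA k).conjTranspose

theorem diagTuples_commute {m p : ℕ} {A B : Fin m → SU p} (hA : A ∈ diagTuples m p)
    (hB : B ∈ diagTuples m p) : A * B = B * A := by
  funext k
  apply Subtype.ext
  rw [Pi.mul_apply, Pi.mul_apply, Submonoid.coe_mul, Submonoid.coe_mul, ← (hA k).diagonal_diag,
    ← (hB k).diagonal_diag, Matrix.diagonal_mul_diagonal, Matrix.diagonal_mul_diagonal]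
  simp only [mul_comm]

/-- The standard maximal torus `T` of `G_{m,p}`: the classes of tuples of diagonal matrices. -/
def maxTorus (m p : ℕ) : Subgroup (CentralProd m p) :=
  (diagTuples m p).map (QuotientGroup.mk' (diagCenter m p))

/-- `Σ_p` acts on `SU(p)` by simultaneous permutation of rows and columns, that is, by conjugation
with permutation matrices: `(s A)_{ij} = A_{s⁻¹ i, s⁻¹ j}`. -/
def permSU {p : ℕ} (s : Equiv.Perm (Fin p)) : SU p →* SU p where
  toFun A := ⟨(A : Matrix (Fin p) (Fin p) ℂ).submatrix s.symm s.symm, by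
    have h := A.2
    rw [Matrix.mem_specialUnitaryGroup_iff, Matrix.mem_unitaryGroup_iff] at h ⊢
    constructor
    · rw [Matrix.star_eq_conjTranspose, Matrix.conjTranspose_submatrix,
        Matrix.submatrix_mul_equiv, ← Matrix.star_eq_conjTranspose, h.1,
        Matrix.submatrix_one_equiv]
    · rw [Matrix.det_submatrix_equiv_self, h.2]⟩
  map_one' := Subtype.ext (Matrix.submatrix_one_equiv _)
  map_mul' A B := Subtype.ext (Matrix.submatrix_mul_equiv _ _ _ _ _).symm

theorem permSU_one {p : ℕ} (A : SU p) : permSU 1 A = A := rfl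

theorem permSU_mul {p : ℕ} (s t : Equiv.Perm (Fin p)) (A : SU p) :
    permSU (s * t) A = permSU s (permSU t A) := rfl

/-- The componentwise action of `(Σ_p)^m` on `SU(p)^m`. -/
def permTuple {m p : ℕ} (s : Fin m → Equiv.Perm (Fin p)) : (Fin m → SU p) →* (Fin m → SU p) where
  toFun A k := permSU (s k) (A k)
  map_one' := funext fun _ => map_one _
  map_mul' _ _ := funext fun _ => map_mul _ _ _

/-- The action of `(Σ_p)^m` on `G_{m,p}` induced from that on `SU(p)^m`. -/
def permG {m p : ℕ} (s : Fin m → Equiv.Perm (Fin p)) : CentralProd m p →* CentralProd m p :=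
  QuotientGroup.map (diagCenter m p) (diagCenter m p) (permTuple s) (by
    rintro A ⟨a, ha⟩
    refine ⟨a, fun k => ?_⟩
    change (A k : Matrix (Fin p) (Fin p) ℂ).submatrix (s k).symm (s k).symm = _
    rw [ha, Matrix.scalar_apply]
    exact Matrix.submatrix_diagonal_equiv _ _)

/-- The action of `(Σ_p)^m` on the maximal torus `T`, by permuting the diagonal entries. -/
instance weylAction (m p : ℕ) : MulAction (Fin m → Equiv.Perm (Fin p)) (maxTorus m p) where
  smul s t := ⟨permG s t.1, by
    obtain ⟨_, A, hA, rfl⟩ := t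
    exact ⟨permTuple s A, fun k => (hA k).submatrix (s k).symm.injective, rfl⟩⟩
  one_smul t := by
    obtain ⟨_, A, hA, rfl⟩ := t
    rfl
  mul_smul r s t := by
    obtain ⟨_, A, hA, rfl⟩ := t
    rfl

/-- The orbit space `Tⁿ / (Σ_p)^m`, where `T ≅ (S¹)^{(p-1)m}` is the maximal torus of `G_{m,p}` and
`(Σ_p)^m` acts diagonally on `Tⁿ`; it carries the quotient topology. -/
abbrev TorusQuot (n m p : ℕ) : Type :=
  Quotient (MulAction.orbitRel (Fin m → Equiv.Perm (Fin p)) (Fin n → maxTorus m p))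

/-- An `n`-tuple of elements of `T`, seen as a commuting `n`-tuple in `G_{m,p}`. -/
def torusTuple {n m p : ℕ} (t : Fin n → maxTorus m p) : HomZ n (CentralProd m p) :=
  ⟨fun i => (t i : CentralProd m p), fun i j => by
    obtain ⟨A, hA, hAi⟩ := (t i).2
    obtain ⟨B, hB, hBj⟩ := (t j).2
    change Commute (t i : CentralProd m p) (t j : CentralProd m p)
    rw [← hAi, ← hBj, commute_iff_eq, ← map_mul, ← map_mul, diagTuples_commute hA hB]⟩

/-- `N(n,m,p) = p^{(m-1)(n-2)} (pⁿ - 1) (p^{n-1} - 1) / (p² - 1) + 1`, with integer exponents. -/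
def numComp (n m p : ℕ) : ℚ :=
  (p : ℚ) ^ (((m : ℤ) - 1) * ((n : ℤ) - 2)) * ((p : ℚ) ^ (n : ℤ) - 1) *
    ((p : ℚ) ^ ((n : ℤ) - 1) - 1) / ((p : ℚ) ^ 2 - 1) + 1

/-!
A commuting tuple in `G = SU(p)^m / Δ(ℤ/p)` lifts to a tuple in `SU(p)^m` whose commutators lie in
`Δ(ℤ/p) ≅ ZMod p`. There are two kinds of tuples.

If all lifts commute, each of the `m` components is simultaneously diagonalizable
(`SU.exists_conj_isDiag`), so the tuple is conjugate into the maximal torus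
(`exists_mk_torusTuple_eq`). Conjugate diagonal tuples differ by a permutation of the diagonal
entries (`SU.exists_perm_of_conj_isDiag`), so these classes form the orbit space of the Weyl group
(`mk_torusTuple_eq_iff`).

If two of the lifts satisfy `A B = ζ B A` with `ζ ≠ 1`, then in each component they form a pair which
is unique up to conjugation (`Heisenberg.exists_conj_pair`) and acts irreducibly
(`Heisenberg.eq_scalar_of_commute`). Hence everything commuting with this pair in `G` is a word in
it, up to the image of the centre, which has order `p^(m-1)`. `CommutatorPairing` collects these
facts, and they suffice to count the conjugacy classes of such tuples: after a conjugation, the tuple lies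
in the centralizer `E` of a fixed pair, which is `(ZMod p)²` up to the radical, and the tuples in `E`
cover the classes evenly, with as many elements in each fibre as there are pairs in `E` with a given
nonzero commutator (`CommutatorPairing.finite_and_card_nondegenerateClasses`). Counting spanning
tuples in the plane over `ZMod p` gives the number `numComp n m p - 1`.

Topologically, the moduli space is a disjoint union of the image of the compact space `Tⁿ` and of
finitely many points, all closed because `G` is compact. So the pieces are open as well, and the
bijection with `Tⁿ / (Σ_p)^m ⊔ X` is a homeomorphism (`exists_homeomorph`); no continuity of
the commutator pairing is needed. The torus and `G` are path connected, which identifies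
the path components upstairs and downstairs.
-/

/-! ### Topology of `SU(p)` -/

namespace SU

instance instIsTopologicalGroup (p : ℕ) : IsTopologicalGroup (SU p) where
  continuous_inv := by
    refine continuous_induced_rng.2 ?_
    exact continuous_star.comp continuous_subtype_val

theorem norm_entry_le {p : ℕ} (A : SU p) (i j : Fin p) :
    ‖(A : Matrix (Fin p) (Fin p) ℂ) i j‖ ≤ 1 :=
  entry_norm_bound_of_unitary A.2.1 i j

instance instCompactSpace (p : ℕ) : CompactSpace (SU p) := by
  refine (isCompact_iff_compactSpace (s := (Matrix.specialUnitaryGroup (Fin p) ℂ :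
    Set (Matrix (Fin p) (Fin p) ℂ)))).1 ?_
  have hK : IsCompact (Set.univ.pi fun _ : Fin p => Set.univ.pi fun _ : Fin p =>
      Metric.closedBall (0 : ℂ) 1) :=
    isCompact_univ_pi fun _ => isCompact_univ_pi fun _ => isCompact_closedBall _ _
  refine hK.of_isClosed_subset ?_ ?_
  · have : (Matrix.specialUnitaryGroup (Fin p) ℂ : Set (Matrix (Fin p) (Fin p) ℂ)) =
        {A | A * star A = 1} ∩ {A | A.det = 1} := by
      ext A
      exact Matrix.mem_specialUnitaryGroup_iff.trans
        (and_congr_left' Matrix.mem_unitaryGroup_iff)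
    rw [this]
    refine IsClosed.inter (isClosed_eq ?_ continuous_const) (isClosed_eq ?_ continuous_const)
    · exact continuous_id.mul (continuous_star (R := Matrix (Fin p) (Fin p) ℂ))
    · exact continuous_id.matrix_det
  · intro A hA i _ j _
    simpa using norm_entry_le ⟨A, hA⟩ i j

/-- A unitary matrix becomes special unitary after division by a `p`-th root of its determinant. -/
theorem exists_smul_mem {p : ℕ} (hp : p ≠ 0) {U : Matrix (Fin p) (Fin p) ℂ}
    (hU : U ∈ Matrix.unitaryGroup (Fin p) ℂ) :
    ∃ c : ℂ, c ≠ 0 ∧ c • U ∈ Matrix.specialUnitaryGroup (Fin p) ℂ := by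
  obtain ⟨d, hd⟩ := IsAlgClosed.exists_pow_nat_eq (U.det) (Nat.pos_of_ne_zero hp)
  have hdet : ‖U.det‖ = 1 := by
    have := Matrix.det_of_mem_unitary hU
    exact CStarRing.norm_of_mem_unitary this
  have hd1 : ‖d‖ = 1 := by
    rw [← hd, norm_pow] at hdet
    exact (pow_eq_one_iff_of_nonneg (norm_nonneg _) hp).1 hdet
  have hd0 : d ≠ 0 := by
    rintro rfl
    simp at hd1
  refine ⟨d⁻¹, inv_ne_zero hd0, Matrix.mem_specialUnitaryGroup_iff.2 ⟨?_, ?_⟩⟩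
  · rw [Matrix.mem_unitaryGroup_iff] at hU ⊢
    have : d⁻¹ * star d⁻¹ = 1 := by
      have := Complex.mul_conj d⁻¹
      rw [Complex.normSq_eq_norm_sq, norm_inv, hd1] at this
      simpa using this
    rw [star_smul, smul_mul_smul_comm, hU, this, one_smul]
  · rw [Matrix.det_smul, ← hd, Fintype.card_fin, inv_pow, inv_mul_cancel₀ (pow_ne_zero _ hd0)]

@[simp] theorem coe_mul {p : ℕ} (A B : SU p) :
    ((A * B : SU p) : Matrix (Fin p) (Fin p) ℂ) = A * B := rfl

@[simp] theorem coe_inv {p : ℕ} (A : SU p) :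
    ((A⁻¹ : SU p) : Matrix (Fin p) (Fin p) ℂ) = star (A : Matrix (Fin p) (Fin p) ℂ) := rfl

theorem star_mul_self {p : ℕ} (A : SU p) :
    star (A : Matrix (Fin p) (Fin p) ℂ) * A = 1 := A.2.1.1

theorem mul_star_self {p : ℕ} (A : SU p) :
    (A : Matrix (Fin p) (Fin p) ℂ) * star (A : Matrix (Fin p) (Fin p) ℂ) = 1 := A.2.1.2

/-- If a unitary matrix intertwines two families in `SU(p)`, so does an element of `SU(p)`. -/
theorem exists_conj_of_unitary {p : ℕ} (hp : p ≠ 0) {U : Matrix (Fin p) (Fin p) ℂ}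
    (hU : U ∈ Matrix.unitaryGroup (Fin p) ℂ) :
    ∃ g : SU p, ∀ A : SU p, ∀ B : Matrix (Fin p) (Fin p) ℂ,
      U * (A : Matrix (Fin p) (Fin p) ℂ) = B * U →
        ((g * A * g⁻¹ : SU p) : Matrix (Fin p) (Fin p) ℂ) = B := by
  obtain ⟨c, -, hcU⟩ := exists_smul_mem hp hU
  refine ⟨⟨c • U, hcU⟩, fun A B h => ?_⟩
  have h1 := mul_star_self ⟨c • U, hcU⟩
  simp only [coe_mul, coe_inv] at h1 ⊢
  rw [Matrix.smul_mul, h, ← Matrix.mul_smul, Matrix.mul_assoc, h1, Matrix.mul_one]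

end SU

/-! ### Simultaneous diagonalization -/

namespace SU

open Matrix in
/-- Commuting special unitary matrices are simultaneously diagonalizable by a special unitary
matrix: their Hermitian and skew-Hermitian parts form a commuting family of symmetric operators. -/
theorem exists_conj_isDiag {ι : Type} [Finite ι] {p : ℕ} (hp : p ≠ 0) (A : ι → SU p)
    (hA : ∀ i j, Commute (A i) (A j)) :
    ∃ g : SU p, ∀ i, ((g * A i * g⁻¹ : SU p) : Matrix (Fin p) (Fin p) ℂ).IsDiag := by
  classical
  let a : ι → Matrix (Fin p) (Fin p) ℂ := fun i => A i
  have haa (i j) : Commute (a i) (a j) := congrArg Subtype.val (hA i j)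
  have has (i j) : Commute (a i) (star (a j)) :=
    congrArg Subtype.val ((hA i j).inv_right : Commute (A i) (A j)⁻¹)
  have hss (i j) : Commute (star (a i)) (star (a j)) := (haa i j).star_star
  let R : ι × Bool → Matrix (Fin p) (Fin p) ℂ := fun x =>
    bif x.2 then a x.1 + star (a x.1) else Complex.I • (a x.1 - star (a x.1))
  have hR (x) : (R x).IsHermitian := by
    obtain ⟨i, _ | _⟩ := x
    · change star _ = _
      simp only [R, cond_false, star_smul, star_sub, star_star]
      rw [← neg_sub, smul_neg, ← neg_smul]
      simp
    · change star _ = _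
      simp only [R, cond_true, star_add, star_star]
      rw [add_comm]
  have hRc (x y) : Commute (R x) (R y) := by
    obtain ⟨i, _ | _⟩ := x <;> obtain ⟨j, _ | _⟩ := y <;> simp only [R, cond_false, cond_true]
    · refine Commute.smul_left (Commute.smul_right ?_ _) _
      exact ((haa i j).sub_right (has i j)).sub_left ((has j i).symm.sub_right (hss i j))
    · refine Commute.smul_left ?_ _
      exact ((haa i j).add_right (has i j)).sub_left ((has j i).symm.add_right (hss i j))
    · refine Commute.smul_right ?_ _
      exact ((haa i j).sub_right (has i j)).add_left ((has j i).symm.sub_right (hss i j))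
    · exact ((haa i j).add_right (has i j)).add_left ((has j i).symm.add_right (hss i j))
  let T : ι × Bool → EuclideanSpace ℂ (Fin p) →ₗ[ℂ] EuclideanSpace ℂ (Fin p) :=
    fun x => Matrix.toEuclideanLin (R x)
  have hT (x) : (T x).IsSymmetric := Matrix.isSymmetric_toEuclideanLin_iff.2 (hR x)
  have hTc : Pairwise (Function.onFun Commute T) := by
    intro x y _
    change T x * T y = T y * T x
    ext v
    simp only [T, Module.End.mul_apply, Matrix.toLpLin_apply, Matrix.mulVec_mulVec]
    rw [(hRc x y).eq]
  have hint := DirectSum.isInternal_ne_bot_iff.2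
    (LinearMap.IsSymmetric.directSum_isInternal_of_pairwise_commute hT hTc)
  have hfin := WellFoundedGT.finite_ne_bot_of_iSupIndep
    (LinearMap.IsSymmetric.directSum_isInternal_of_pairwise_commute hT hTc).submodule_iSupIndep
  have : Fintype {χ : ι × Bool → ℂ // (⨅ x, Module.End.eigenspace (T x) (χ x)) ≠ ⊥} :=
    hfin.fintype
  have horth := (LinearMap.IsSymmetric.orthogonalFamily_iInf_eigenspaces hT).comp
    (Subtype.val_injective (p := fun χ : ι × Bool → ℂ =>
      (⨅ x, Module.End.eigenspace (T x) (χ x)) ≠ ⊥))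
  have hdim : Module.finrank ℂ (EuclideanSpace ℂ (Fin p)) = p := by simp
  let b := hint.subordinateOrthonormalBasis hdim horth
  have hb (x) (j : Fin p) : ∃ c : ℂ, T x (b j) = c • b j := by
    have := hint.subordinateOrthonormalBasis_subordinate hdim j horth
    rw [Submodule.mem_iInf] at this
    exact ⟨_, Module.End.mem_eigenspace_iff.1 (this x)⟩
  have hab (i) (j : Fin p) : ∃ c : ℂ, a i *ᵥ (b j).ofLp = c • (b j).ofLp := by
    obtain ⟨c, hc⟩ := hb (i, true) j
    obtain ⟨d, hd⟩ := hb (i, false) j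
    have hc' : (a i + star (a i)) *ᵥ (b j).ofLp = c • (b j).ofLp := congrArg WithLp.ofLp hc
    have hd' : (Complex.I • (a i - star (a i))) *ᵥ (b j).ofLp = d • (b j).ofLp :=
      congrArg WithLp.ofLp hd
    refine ⟨(c - Complex.I * d) / 2, ?_⟩
    have key : a i = (2⁻¹ : ℂ) • (a i + star (a i)) -
        (2⁻¹ * Complex.I) • (Complex.I • (a i - star (a i))) := by
      rw [smul_smul, mul_assoc, Complex.I_mul_I]
      module
    rw [key, Matrix.sub_mulVec, Matrix.smul_mulVec, Matrix.smul_mulVec, hc', hd']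
    module
  let V : Matrix (Fin p) (Fin p) ℂ := Matrix.of fun i j => (b j).ofLp i
  have hVV : star V * V = 1 := by
    ext i j
    have := orthonormal_iff_ite.1 b.orthonormal i j
    rw [EuclideanSpace.inner_eq_star_dotProduct] at this
    rw [Matrix.mul_apply, Matrix.one_apply, ← this, dotProduct]
    refine Finset.sum_congr rfl fun k _ => ?_
    rw [mul_comm]
    rfl
  have hVU : star V ∈ Matrix.unitaryGroup (Fin p) ℂ := by
    rw [Matrix.mem_unitaryGroup_iff, star_star, hVV]
  obtain ⟨g, hg⟩ := exists_conj_of_unitary hp hVU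
  refine ⟨g, fun i => ?_⟩
  rw [hg (A i) (star V * a i * V) ?_]
  · intro j k hjk
    obtain ⟨c, hc⟩ := hab i k
    have : ∀ l, (a i * V) l k = c * V l k := fun l => congrFun hc l
    rw [Matrix.mul_assoc, Matrix.mul_apply]
    simp_rw [this, mul_left_comm _ c]
    rw [← Finset.mul_sum, ← Matrix.mul_apply, hVV, Matrix.one_apply_ne hjk, mul_zero]
  · rw [Matrix.mul_assoc _ V, mul_eq_one_comm.1 hVV, Matrix.mul_one]

/-- Two families of diagonal matrices that are simultaneously conjugate differ by a permutation of
the diagonal entries: a nonvanishing term of the Leibniz expansion of the determinant of the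
conjugating matrix matches equal joint eigenvalues. -/
theorem exists_perm_of_conj_isDiag {ι : Type} {p : ℕ} (A B : ι → SU p)
    (hA : ∀ i, (A i : Matrix (Fin p) (Fin p) ℂ).IsDiag)
    (hB : ∀ i, (B i : Matrix (Fin p) (Fin p) ℂ).IsDiag) (g : SU p)
    (hg : ∀ i, A i = g * B i * g⁻¹) :
    ∃ s : Equiv.Perm (Fin p), ∀ i, A i = permSU s (B i) := by
  have hdet : (g : Matrix (Fin p) (Fin p) ℂ).det ≠ 0 := by
    rw [(Matrix.mem_specialUnitaryGroup_iff.1 g.2).2]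
    exact one_ne_zero
  obtain ⟨s, hs⟩ : ∃ s : Equiv.Perm (Fin p), ∀ j, (g : Matrix (Fin p) (Fin p) ℂ) (s j) j ≠ 0 := by
    by_contra! h
    refine hdet ?_
    rw [Matrix.det_apply]
    refine Finset.sum_eq_zero fun s _ => ?_
    obtain ⟨j, hj⟩ := h s
    have : ∏ i, (g : Matrix (Fin p) (Fin p) ℂ) (s i) i = 0 :=
      Finset.prod_eq_zero (Finset.mem_univ j) hj
    exact (congrArg _ this).trans (smul_zero _)
  refine ⟨s, fun i => ?_⟩
  have h1 : (A i : Matrix (Fin p) (Fin p) ℂ) * g = g * B i := by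
    have : A i * g = g * B i := by rw [hg i, inv_mul_cancel_right]
    exact congrArg Subtype.val this
  have h2 (j) : (A i : Matrix (Fin p) (Fin p) ℂ) (s j) (s j) =
      (B i : Matrix (Fin p) (Fin p) ℂ) j j := by
    have h3 := congrFun (congrFun h1 (s j)) j
    rw [← (hA i).diagonal_diag, ← (hB i).diagonal_diag, Matrix.diagonal_mul,
      Matrix.mul_diagonal, mul_comm] at h3
    exact mul_left_cancel₀ (hs j) h3
  apply Subtype.ext
  ext j k
  change _ = (B i : Matrix (Fin p) (Fin p) ℂ) (s.symm j) (s.symm k)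
  by_cases hjk : j = k
  · subst hjk
    simpa using h2 (s.symm j)
  · rw [hA i hjk, hB i (s.symm.injective.ne hjk)]

end SU

/-! ### Pairs commuting up to a primitive root of unity -/

namespace Heisenberg

open Matrix

variable {p : ℕ}

/-- The matrix whose `j`-th column is `B ^ j v`. -/
def orbitMatrix (B : Matrix (Fin p) (Fin p) ℂ) (v : Fin p → ℂ) : Matrix (Fin p) (Fin p) ℂ :=
  Matrix.of fun i j => (B ^ (j : ℕ) *ᵥ v) i

theorem mul_orbitMatrix_apply (A B : Matrix (Fin p) (Fin p) ℂ) (v : Fin p → ℂ) (i j : Fin p) :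
    (A * orbitMatrix B v) i j = (A *ᵥ (B ^ (j : ℕ) *ᵥ v)) i := rfl

section

variable {A B : Matrix (Fin p) (Fin p) ℂ} {ζ c : ℂ} {v : Fin p → ℂ}

theorem mul_pow_eq (hAB : A * B = ζ • (B * A)) (j : ℕ) : A * B ^ j = ζ ^ j • (B ^ j * A) := by
  induction j with
  | zero => simp
  | succ j ih =>
    rw [pow_succ, ← Matrix.mul_assoc, ih, Matrix.smul_mul, Matrix.mul_assoc, hAB, Matrix.mul_smul,
      smul_smul, ← Matrix.mul_assoc, ← pow_succ]

theorem mulVec_pow_mulVec (hAB : A * B = ζ • (B * A)) (hv : A *ᵥ v = c • v) (j : ℕ) :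
    A *ᵥ (B ^ j *ᵥ v) = (c * ζ ^ j) • (B ^ j *ᵥ v) := by
  rw [Matrix.mulVec_mulVec, mul_pow_eq hAB, Matrix.smul_mulVec, ← Matrix.mulVec_mulVec, hv,
    Matrix.mulVec_smul, smul_smul, mul_comm]

theorem mul_orbitMatrix (hAB : A * B = ζ • (B * A)) (hv : A *ᵥ v = c • v) :
    A * orbitMatrix B v = orbitMatrix B v * diagonal fun j : Fin p => c * ζ ^ (j : ℕ) := by
  ext i j
  rw [mul_orbitMatrix_apply, mulVec_pow_mulVec hAB hv, Matrix.mul_diagonal,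
    mul_comm (orbitMatrix B v i j)]
  rfl

theorem star_mulVec_dotProduct (hA : star A * A = 1) (v w : Fin p → ℂ) :
    star (A *ᵥ v) ⬝ᵥ (A *ᵥ w) = star v ⬝ᵥ w := by
  rw [Matrix.star_mulVec, Matrix.dotProduct_mulVec, Matrix.vecMul_vecMul,
    ← Matrix.star_eq_conjTranspose, hA, Matrix.vecMul_one]

theorem star_pow_mul_pow (hB : star B * B = 1) (j : ℕ) : star (B ^ j) * B ^ j = 1 := by
  have : B ∈ Matrix.unitaryGroup (Fin p) ℂ := Matrix.mem_unitaryGroup_iff'.2 hB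
  exact Matrix.mem_unitaryGroup_iff'.1 (pow_mem this j)

/-- The vectors `B ^ j v` are unit eigenvectors of the unitary matrix `A` for distinct eigenvalues,
hence orthonormal. -/
theorem star_orbitMatrix_mul_self (hζ : IsPrimitiveRoot ζ p) (hA : star A * A = 1)
    (hB : star B * B = 1) (hAB : A * B = ζ • (B * A)) (hv : A *ᵥ v = c • v)
    (hv1 : star v ⬝ᵥ v = 1) : star (orbitMatrix B v) * orbitMatrix B v = 1 := by
  have hentry (i j : Fin p) : (star (orbitMatrix B v) * orbitMatrix B v) i j =
      star (B ^ (i : ℕ) *ᵥ v) ⬝ᵥ (B ^ (j : ℕ) *ᵥ v) := rfl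
  have hc : star c * c = 1 := by
    have := star_mulVec_dotProduct hA v v
    rw [hv, star_smul, smul_dotProduct, dotProduct_smul, hv1] at this
    simpa using this
  ext i j
  rw [hentry]
  by_cases hij : i = j
  · subst hij
    rw [star_mulVec_dotProduct (star_pow_mul_pow hB _), hv1, Matrix.one_apply_eq]
  · rw [Matrix.one_apply_ne hij]
    have h1 := star_mulVec_dotProduct hA (B ^ (i : ℕ) *ᵥ v) (B ^ (j : ℕ) *ᵥ v)
    rw [mulVec_pow_mulVec hAB hv, mulVec_pow_mulVec hAB hv, star_smul, smul_dotProduct,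
      dotProduct_smul, smul_eq_mul, smul_eq_mul, ← mul_assoc] at h1
    by_contra h2
    have h3 := mul_right_cancel₀ h2 (h1.trans (one_mul _).symm)
    have hp : p ≠ 0 := fun h => by subst h; exact i.elim0
    have hz : star ζ * ζ = 1 := by
      have h := Complex.conj_mul' ζ
      rw [hζ.norm'_eq_one hp] at h
      simpa using h
    have hzi : star (ζ ^ (i : ℕ)) * ζ ^ (i : ℕ) = 1 := by
      rw [star_pow, ← mul_pow, hz, one_pow]
    have hci : star (c * ζ ^ (i : ℕ)) * (c * ζ ^ (i : ℕ)) = 1 := by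
      rw [star_mul']
      calc _ = (star c * c) * (star (ζ ^ (i : ℕ)) * ζ ^ (i : ℕ)) := by ring
        _ = 1 := by rw [hc, hzi, one_mul]
    have h4 := mul_left_cancel₀ (left_ne_zero_of_mul_eq_one h3) (h3.trans hci.symm)
    have hc0 : c ≠ 0 := right_ne_zero_of_mul_eq_one hc
    exact hij (Fin.ext (hζ.pow_inj i.2 j.2 (mul_left_cancel₀ hc0 h4).symm))

/-- The eigenspaces of `A` are one-dimensional. -/
theorem eq_smul_of_mulVec_eq [NeZero p] (hζ : IsPrimitiveRoot ζ p) (hA : star A * A = 1)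
    (hB : star B * B = 1) (hAB : A * B = ζ • (B * A)) (hv : A *ᵥ v = c • v)
    (hv1 : star v ⬝ᵥ v = 1) {w : Fin p → ℂ} (hw : A *ᵥ w = c • w) : ∃ d : ℂ, w = d • v := by
  have hU := star_orbitMatrix_mul_self hζ hA hB hAB hv hv1
  have hU' := mul_eq_one_comm.1 hU
  set U := orbitMatrix B v with hUdef
  have hc0 : c ≠ 0 := by
    rintro rfl
    have := star_mulVec_dotProduct hA v v
    rw [hv, hv1, zero_smul] at this
    simp at this
  let x := star U *ᵥ w
  have hx : U *ᵥ x = w := by rw [Matrix.mulVec_mulVec, hU', Matrix.one_mulVec]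
  have hDx : (diagonal fun j : Fin p => c * ζ ^ (j : ℕ)) *ᵥ x = c • x := by
    have h1 : star U *ᵥ (A *ᵥ (U *ᵥ x)) = (diagonal fun j : Fin p => c * ζ ^ (j : ℕ)) *ᵥ x := by
      rw [Matrix.mulVec_mulVec, Matrix.mulVec_mulVec, Matrix.mul_assoc, hUdef,
        mul_orbitMatrix hAB hv, ← hUdef, ← Matrix.mul_assoc, hU, Matrix.one_mul]
    rw [← h1, hx, hw, Matrix.mulVec_smul]
  have hx0 (j : Fin p) (hj : j ≠ 0) : x j = 0 := by
    have h := congrFun hDx j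
    rw [Matrix.mulVec_diagonal, Pi.smul_apply, smul_eq_mul, mul_assoc] at h
    have h2 := mul_left_cancel₀ hc0 h
    by_contra h3
    have h4 : ζ ^ (j : ℕ) = ζ ^ (0 : ℕ) := by
      rw [pow_zero]
      exact mul_right_cancel₀ h3 (h2.trans (one_mul _).symm)
    exact hj (Fin.ext (hζ.pow_inj j.2 (NeZero.pos p) h4))
  refine ⟨x 0, ?_⟩
  rw [← hx]
  ext i
  rw [Matrix.mulVec, dotProduct, Finset.sum_eq_single 0 (fun j _ hj => by rw [hx0 j hj, mul_zero])
    (fun h => absurd (Finset.mem_univ _) h), hUdef]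
  simp [orbitMatrix, mul_comm]

end

theorem exists_unit_eigenvector [NeZero p] (A : Matrix (Fin p) (Fin p) ℂ) :
    ∃ (c : ℂ) (v : Fin p → ℂ), A *ᵥ v = c • v ∧ star v ⬝ᵥ v = 1 := by
  obtain ⟨c, hc⟩ := Module.End.exists_eigenvalue (Matrix.toEuclideanLin A)
  obtain ⟨v, hv, hv0⟩ := hc.exists_hasEigenvector
  rw [Module.End.mem_eigenspace_iff] at hv
  let w : EuclideanSpace ℂ (Fin p) := ((‖v‖ : ℂ)⁻¹) • v
  have hw : Matrix.toEuclideanLin A w = c • w := by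
    rw [map_smul, hv, smul_comm]
  refine ⟨c, w.ofLp, congrArg WithLp.ofLp hw, ?_⟩
  have h1 : ‖w‖ = 1 := norm_smul_inv_norm hv0
  have h2 := inner_self_eq_norm_sq_to_K (𝕜 := ℂ) w
  rw [EuclideanSpace.inner_eq_star_dotProduct, h1, dotProduct_comm] at h2
  simpa using h2

/-- The cyclic shift `e_j ↦ e_{j+1}`, with the entry wrapping around replaced by `μ`. -/
def shift (p : ℕ) [NeZero p] (μ : ℂ) : Matrix (Fin p) (Fin p) ℂ :=
  (Matrix.of fun i j => if i = j + 1 then 1 else 0) *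
    diagonal fun j => if j + 1 = 0 then μ else 1

theorem shift_apply [NeZero p] (μ : ℂ) (i j : Fin p) :
    shift p μ i j = if i = j + 1 then (if j + 1 = 0 then μ else 1) else 0 := by
  rw [shift, Matrix.mul_diagonal, Matrix.of_apply, ite_mul, one_mul, zero_mul]

theorem det_shift [NeZero p] (μ : ℂ) :
    (shift p μ).det = (Matrix.of fun i j : Fin p => if i = j + 1 then (1 : ℂ) else 0).det * μ := by
  rw [shift, Matrix.det_mul, Matrix.det_diagonal]
  congr 1
  rw [Finset.prod_eq_single (-1 : Fin p)]
  · simp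
  · intro j _ hj
    rw [if_neg]
    exact fun h => hj (eq_neg_of_add_eq_zero_left h)
  · simp

variable {A B : Matrix (Fin p) (Fin p) ℂ} {ζ c : ℂ} {v : Fin p → ℂ}

/-- `B` permutes the basis `B ^ j v` cyclically, since `B ^ p v` is again an eigenvector of `A` for the
eigenvalue of `v`. -/
theorem exists_mul_orbitMatrix_eq_shift [NeZero p] (hζ : IsPrimitiveRoot ζ p) (hA : star A * A = 1)
    (hB : star B * B = 1) (hAB : A * B = ζ • (B * A)) (hv : A *ᵥ v = c • v)
    (hv1 : star v ⬝ᵥ v = 1) :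
    ∃ μ : ℂ, B * orbitMatrix B v = orbitMatrix B v * shift p μ := by
  obtain ⟨μ, hμ⟩ := eq_smul_of_mulVec_eq hζ hA hB hAB hv hv1 (w := B ^ p *ᵥ v) (by
    rw [mulVec_pow_mulVec hAB hv, hζ.pow_eq_one, mul_one])
  refine ⟨μ, ?_⟩
  ext i j
  rw [mul_orbitMatrix_apply, Matrix.mulVec_mulVec, ← pow_succ', Matrix.mul_apply]
  rw [Finset.sum_eq_single (j + 1)
    (fun k _ hk => by rw [shift_apply, if_neg hk, mul_zero])
    (fun h => absurd (Finset.mem_univ _) h), shift_apply, if_pos rfl]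
  change _ = (B ^ ((j + 1 : Fin p) : ℕ) *ᵥ v) i * _
  by_cases hj : (j : ℕ) + 1 = p
  · have hj0 : j + 1 = 0 := by
      apply Fin.ext
      rw [Fin.val_add, Fin.val_one', Nat.add_mod_mod, hj]
      simp
    rw [if_pos hj0, hj, hμ, hj0]
    simp [mul_comm]
  · have hlt : (j : ℕ) + 1 < p := lt_of_le_of_ne j.2 hj
    have hval : ((j + 1 : Fin p) : ℕ) = j + 1 := by
      rw [Fin.val_add, Fin.val_one', Nat.add_mod_mod, Nat.mod_eq_of_lt hlt]
    rw [if_neg, mul_one, hval]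
    intro h
    rw [h] at hval
    simp at hval

/-- Schur's lemma for the pair `A`, `B`. -/
theorem eq_scalar_of_commute [NeZero p] (hζ : IsPrimitiveRoot ζ p) (hA : star A * A = 1)
    (hB : star B * B = 1) (hAB : A * B = ζ • (B * A)) {X : Matrix (Fin p) (Fin p) ℂ}
    (hXA : Commute X A) (hXB : Commute X B) : ∃ d : ℂ, X = Matrix.scalar (Fin p) d := by
  obtain ⟨c, v, hv, hv1⟩ := exists_unit_eigenvector A
  obtain ⟨d, hd⟩ := eq_smul_of_mulVec_eq hζ hA hB hAB hv hv1 (w := X *ᵥ v) (by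
    rw [Matrix.mulVec_mulVec, ← hXA.eq, ← Matrix.mulVec_mulVec, hv, Matrix.mulVec_smul])
  have hU := mul_eq_one_comm.1 (star_orbitMatrix_mul_self hζ hA hB hAB hv hv1)
  refine ⟨d, ?_⟩
  have h : X * orbitMatrix B v = Matrix.scalar (Fin p) d * orbitMatrix B v := by
    ext i j
    rw [mul_orbitMatrix_apply, Matrix.mulVec_mulVec, (hXB.pow_right _).eq, ← Matrix.mulVec_mulVec,
      hd, Matrix.mulVec_smul, Matrix.scalar_apply, Matrix.diagonal_mul]
    rfl
  calc X = X * orbitMatrix B v * star (orbitMatrix B v) := by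
        rw [Matrix.mul_assoc, hU, Matrix.mul_one]
    _ = _ := by rw [h, Matrix.mul_assoc, hU, Matrix.mul_one]

/-- A pair in `SU(p)` with `A B = ζ B A`, for a fixed primitive `p`-th root of unity `ζ`, is unique
up to conjugation in `SU(p)`. In the basis `B ^ j v`, with `v` an eigenvector of `A` of eigenvalue
`c`, the pair is determined by `c` and by the scalar `B ^ p`; the determinant of `B` fixes
the latter, and that of `A` fixes `c` up to a power of `ζ`, that is, up to the choice of `v`. -/
theorem exists_conj_pair [NeZero p] (hζ : IsPrimitiveRoot ζ p) {A B A' B' : SU p}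
    (hAB : (A : Matrix (Fin p) (Fin p) ℂ) * B = ζ • ((B : Matrix (Fin p) (Fin p) ℂ) * A))
    (hAB' : (A' : Matrix (Fin p) (Fin p) ℂ) * B' = ζ • ((B' : Matrix (Fin p) (Fin p) ℂ) * A')) :
    ∃ g : SU p, g * A * g⁻¹ = A' ∧ g * B * g⁻¹ = B' := by
  have detA (A B : SU p)
      (hAB : (A : Matrix (Fin p) (Fin p) ℂ) * B = ζ • ((B : Matrix (Fin p) (Fin p) ℂ) * A))
      {c : ℂ} {v : Fin p → ℂ} (hv : (A : Matrix (Fin p) (Fin p) ℂ) *ᵥ v = c • v)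
      (hv1 : star v ⬝ᵥ v = 1) : c ^ p * ∏ j : Fin p, ζ ^ (j : ℕ) = 1 := by
    have hU := star_orbitMatrix_mul_self hζ (SU.star_mul_self A) (SU.star_mul_self B) hAB hv hv1
    have hdet : (orbitMatrix (B : Matrix (Fin p) (Fin p) ℂ) v).det ≠ 0 := by
      intro h
      have := congrArg Matrix.det hU
      rw [Matrix.det_mul, h, mul_zero, Matrix.det_one] at this
      exact zero_ne_one this
    have h := congrArg Matrix.det (mul_orbitMatrix hAB hv)
    rw [Matrix.det_mul, Matrix.det_mul, (Matrix.mem_specialUnitaryGroup_iff.1 A.2).2, mul_comm,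
      Matrix.det_diagonal, Finset.prod_mul_distrib, Finset.prod_const, Finset.card_univ,
      Fintype.card_fin] at h
    exact (mul_left_cancel₀ hdet h).symm
  have detB (A B : SU p)
      (hAB : (A : Matrix (Fin p) (Fin p) ℂ) * B = ζ • ((B : Matrix (Fin p) (Fin p) ℂ) * A))
      {c : ℂ} {v : Fin p → ℂ} (hv : (A : Matrix (Fin p) (Fin p) ℂ) *ᵥ v = c • v)
      (hv1 : star v ⬝ᵥ v = 1) {μ : ℂ}
      (hμ : (B : Matrix (Fin p) (Fin p) ℂ) * orbitMatrix (B : Matrix (Fin p) (Fin p) ℂ) v =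
        orbitMatrix (B : Matrix (Fin p) (Fin p) ℂ) v * shift p μ) :
      (Matrix.of fun i j : Fin p => if i = j + 1 then (1 : ℂ) else 0).det * μ = 1 := by
    have hU := star_orbitMatrix_mul_self hζ (SU.star_mul_self A) (SU.star_mul_self B) hAB hv hv1
    have hdet : (orbitMatrix (B : Matrix (Fin p) (Fin p) ℂ) v).det ≠ 0 := by
      intro h
      have := congrArg Matrix.det hU
      rw [Matrix.det_mul, h, mul_zero, Matrix.det_one] at this
      exact zero_ne_one this
    have h := congrArg Matrix.det hμ
    rw [Matrix.det_mul, Matrix.det_mul, (Matrix.mem_specialUnitaryGroup_iff.1 B.2).2, mul_comm,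
      det_shift] at h
    exact (mul_left_cancel₀ hdet h).symm
  obtain ⟨c, v, hv, hv1⟩ := exists_unit_eigenvector (A : Matrix (Fin p) (Fin p) ℂ)
  obtain ⟨w, hw, hw1⟩ : ∃ w : Fin p → ℂ,
      (A' : Matrix (Fin p) (Fin p) ℂ) *ᵥ w = c • w ∧ star w ⬝ᵥ w = 1 := by
    obtain ⟨c', w, hw, hw1⟩ := exists_unit_eigenvector (A' : Matrix (Fin p) (Fin p) ℂ)
    have h := detA A B hAB hv hv1
    have h' := detA A' B' hAB' hw hw1
    have hc' : c' ≠ 0 := by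
      rintro rfl
      rw [zero_pow (NeZero.ne p), zero_mul] at h'
      exact zero_ne_one h'
    have hpow : (c / c') ^ p = 1 := by
      rw [div_pow, div_eq_one_iff_eq (pow_ne_zero _ hc')]
      exact mul_right_cancel₀ (right_ne_zero_of_mul_eq_one h) (h.trans h'.symm)
    obtain ⟨r, -, hr⟩ := hζ.eq_pow_of_pow_eq_one hpow
    refine ⟨(B' : Matrix (Fin p) (Fin p) ℂ) ^ r *ᵥ w, ?_, ?_⟩
    · rw [mulVec_pow_mulVec hAB' hw, hr, mul_div_cancel₀ _ hc']
    · rw [star_mulVec_dotProduct (star_pow_mul_pow (SU.star_mul_self B') r), hw1]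
  obtain ⟨μ, hμ⟩ := exists_mul_orbitMatrix_eq_shift hζ (SU.star_mul_self A) (SU.star_mul_self B)
    hAB hv hv1
  obtain ⟨ν, hν⟩ := exists_mul_orbitMatrix_eq_shift hζ (SU.star_mul_self A') (SU.star_mul_self B')
    hAB' hw hw1
  have hμν : μ = ν := by
    have h := detB A B hAB hv hv1 hμ
    have h' := detB A' B' hAB' hw hw1 hν
    exact mul_left_cancel₀ (left_ne_zero_of_mul_eq_one h) (h.trans h'.symm)
  subst hμν
  have hU := star_orbitMatrix_mul_self hζ (SU.star_mul_self A) (SU.star_mul_self B) hAB hv hv1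
  have hV := star_orbitMatrix_mul_self hζ (SU.star_mul_self A') (SU.star_mul_self B') hAB' hw hw1
  have hUA := mul_orbitMatrix hAB hv
  have hVA := mul_orbitMatrix hAB' hw
  set U := orbitMatrix (B : Matrix (Fin p) (Fin p) ℂ) v
  set V := orbitMatrix (B' : Matrix (Fin p) (Fin p) ℂ) w
  -- If `X U = U D` and `Y V = V D`, then `V U⁻¹` intertwines `X` and `Y`.
  have hint (X Y D : Matrix (Fin p) (Fin p) ℂ) (hX : X * U = U * D) (hY : Y * V = V * D) :
      V * star U * X = Y * (V * star U) := by
    have h1 : star U * X = D * star U := by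
      calc star U * X = star U * (X * U) * star U := by
            rw [← Matrix.mul_assoc, Matrix.mul_assoc _ U, mul_eq_one_comm.1 hU, Matrix.mul_one]
        _ = D * star U := by rw [hX, ← Matrix.mul_assoc, hU, Matrix.one_mul]
    rw [Matrix.mul_assoc, h1, ← Matrix.mul_assoc, ← hY, Matrix.mul_assoc]
  have hW : V * star U ∈ Matrix.unitaryGroup (Fin p) ℂ := by
    rw [Matrix.mem_unitaryGroup_iff, star_mul, star_star, Matrix.mul_assoc,
      ← Matrix.mul_assoc (star U), hU, Matrix.one_mul, mul_eq_one_comm.1 hV]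
  obtain ⟨g, hg⟩ := SU.exists_conj_of_unitary (NeZero.ne p) hW
  exact ⟨g, Subtype.ext (hg A A' (hint _ _ _ hUA hVA)), Subtype.ext (hg B B' (hint _ _ _ hμ hν))⟩

/-- Suitably normalized clock and shift matrices. -/
theorem exists_pair [NeZero p] (hζ : IsPrimitiveRoot ζ p) : ∃ A B : SU p,
    (A : Matrix (Fin p) (Fin p) ℂ) * B = ζ • ((B : Matrix (Fin p) (Fin p) ℂ) * A) := by
  have hz : ζ * star ζ = 1 := by
    have h := Complex.mul_conj' ζ
    rw [hζ.norm'_eq_one (NeZero.ne p)] at h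
    simpa using h
  have hA : (diagonal fun j : Fin p => ζ ^ (j : ℕ)) ∈ Matrix.unitaryGroup (Fin p) ℂ := by
    rw [Matrix.mem_unitaryGroup_iff, Matrix.star_eq_conjTranspose, Matrix.diagonal_conjTranspose,
      Matrix.diagonal_mul_diagonal, ← Matrix.diagonal_one]
    congr 1
    ext j
    rw [Pi.star_apply, star_pow, ← mul_pow, hz, one_pow]
  have hB : shift p 1 ∈ Matrix.unitaryGroup (Fin p) ℂ := by
    rw [Matrix.mem_unitaryGroup_iff']
    ext i j
    rw [Matrix.mul_apply]
    simp only [Matrix.star_apply, shift_apply, ite_self]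
    simp [Matrix.one_apply, eq_comm]
  obtain ⟨a, -, ha⟩ := SU.exists_smul_mem (NeZero.ne p) hA
  obtain ⟨b, -, hb⟩ := SU.exists_smul_mem (NeZero.ne p) hB
  refine ⟨⟨_, ha⟩, ⟨_, hb⟩, ?_⟩
  simp only [Matrix.smul_mul, Matrix.mul_smul]
  rw [smul_comm a b, smul_comm ζ b, smul_comm ζ a]
  congr 2
  ext i j
  rw [Matrix.diagonal_mul, Matrix.smul_apply, Matrix.mul_diagonal, shift_apply]
  by_cases h : i = j + 1
  · rw [if_pos h, ite_self, mul_one, one_mul, smul_eq_mul, h, Fin.val_add, Fin.val_one',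
      Nat.add_mod_mod, ← pow_eq_pow_mod _ hζ.pow_eq_one, pow_succ']
  · rw [if_neg h, mul_zero, zero_mul, smul_zero]

end Heisenberg

/-! ### Counting commuting tuples with a commutator pairing -/

theorem RepZ.mk_eq_mk_iff {n : ℕ} {G : Type} [Group G] {x y : HomZ n G} :
    (⟦x⟧ : RepZ n G) = ⟦y⟧ ↔ ∃ g : G, ∀ i, x.1 i = g * y.1 i * g⁻¹ := by
  rw [Quotient.eq]
  refine MulAction.mem_orbit_iff.trans ⟨?_, ?_⟩
  · rintro ⟨g, rfl⟩
    exact ⟨ConjAct.ofConjAct g, fun i => rfl⟩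
  · rintro ⟨g, hg⟩
    exact ⟨ConjAct.toConjAct g, Subtype.ext (funext fun i => (hg i).symm)⟩

/-- The number of `n`-tuples of vectors in the plane `F²` that span it: their coordinates are two
linearly independent vectors of `Fⁿ`. -/
theorem card_spanning_tuples (F : Type) [Field F] [Fintype F] (n : ℕ) :
    Nat.card {u : Fin n → F × F // ∃ i j, (u i).1 * (u j).2 - (u i).2 * (u j).1 ≠ 0} =
      (Fintype.card F ^ n - 1) * (Fintype.card F ^ n - Fintype.card F) := by
  rcases lt_or_ge n 2 with hn | hn
  · have : IsEmpty {u : Fin n → F × F // ∃ i j, (u i).1 * (u j).2 - (u i).2 * (u j).1 ≠ 0} := by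
      refine ⟨?_⟩
      rintro ⟨u, i, j, h⟩
      have : i = j := Fin.ext (by omega)
      subst this
      exact h (by ring)
    rw [Nat.card_of_isEmpty]
    interval_cases n <;> simp
  · have h := card_linearIndependent (K := F) (V := Fin n → F) (k := 2) (by simpa using hn)
    rw [Fin.prod_univ_two] at h
    simp only [Module.finrank_fin_fun, Fin.val_zero, Fin.val_one, pow_zero, pow_one] at h
    rw [← h]
    let e : (Fin n → F × F) ≃ (Fin 2 → Fin n → F) :=
      { toFun := fun u => ![fun i => (u i).1, fun i => (u i).2]
        invFun := fun s i => (s 0 i, s 1 i)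
        left_inv := fun u => rfl
        right_inv := fun s => by
          ext k i
          fin_cases k <;> rfl }
    refine Nat.card_congr (e.subtypeEquiv fun u => ?_)
    change _ ↔ LinearIndependent F ![fun i => (u i).1, fun i => (u i).2]
    rw [LinearIndependent.pair_iff]
    constructor
    · rintro ⟨i, j, hij⟩ s t hst
      have hi : s * (u i).1 + t * (u i).2 = 0 := congrFun hst i
      have hj : s * (u j).1 + t * (u j).2 = 0 := congrFun hst j
      constructor
      · refine (mul_eq_zero.1 (?_ : s * _ = 0)).resolve_right hij
        linear_combination (u j).2 * hi - (u i).2 * hj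
      · refine (mul_eq_zero.1 (?_ : t * _ = 0)).resolve_right hij
        linear_combination (u i).1 * hj - (u j).1 * hi
    · intro hli
      by_contra! hdet
      by_cases h0 : ∃ i, (u i).1 ≠ 0
      · obtain ⟨i, hi⟩ := h0
        refine hi (neg_eq_zero.1 (hli (u i).2 (-(u i).1) ?_).2)
        ext j
        have := hdet i j
        simp only [Pi.add_apply, Pi.smul_apply, smul_eq_mul, Pi.zero_apply]
        linear_combination -this
      · push Not at h0
        refine one_ne_zero (hli 1 0 ?_).1
        ext j
        simp [h0 j]

/-- The number of pairs of vectors in the plane with a prescribed nonzero determinant, which is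
the order of `SL₂(F)`. -/
theorem card_det_eq {F : Type} [Field F] [Fintype F] {t : F} (ht : t ≠ 0) :
    Nat.card {z : (F × F) × (F × F) // z.1.1 * z.2.2 - z.1.2 * z.2.1 = t} *
        (Fintype.card F - 1) =
      (Fintype.card F ^ 2 - 1) * (Fintype.card F ^ 2 - Fintype.card F) := by
  classical
  rw [← card_spanning_tuples F 2, ← Fintype.card_units (α := F), ← Nat.card_eq_fintype_card,
    ← Nat.card_prod]
  refine Nat.card_congr (Equiv.trans
    (β := {z : (F × F) × (F × F) // z.1.1 * z.2.2 - z.1.2 * z.2.1 ≠ 0}) ?_ ?_)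
  · exact
    { toFun := fun x => ⟨(x.1.1.1, (x.2 : F) • x.1.1.2), by
        have h := x.1.2
        have : x.1.1.1.1 * ((x.2 : F) * x.1.1.2.2) - x.1.1.1.2 * ((x.2 : F) * x.1.1.2.1) =
          x.2 * t := by linear_combination (x.2 : F) * h
        simpa [this] using ht⟩
      invFun := fun z => ⟨⟨(z.1.1, (t / (z.1.1.1 * z.1.2.2 - z.1.1.2 * z.1.2.1)) • z.1.2), by
        have := z.2
        simp only [Prod.smul_fst, Prod.smul_snd, smul_eq_mul]
        field_simp⟩, Units.mk0 ((z.1.1.1 * z.1.2.2 - z.1.1.2 * z.1.2.1) / t) (div_ne_zero z.2 ht)⟩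
      left_inv := by
        rintro ⟨⟨⟨⟨a, b⟩, ⟨c, d⟩⟩, h⟩, x⟩
        have hx := x.ne_zero
        have h' : a * ((x : F) * d) - b * ((x : F) * c) = x * t := by
          linear_combination (x : F) * h
        simp only [Prod.smul_mk, smul_eq_mul, h']
        ext <;> simp <;> field_simp
      right_inv := by
        rintro ⟨⟨⟨a, b⟩, ⟨c, d⟩⟩, h⟩
        simp only at h
        ext <;> simp <;> field_simp }
  · refine ((finTwoArrowEquiv (F × F)).subtypeEquiv fun u => ?_).symm
    simp only [finTwoArrowEquiv_apply]
    refine ⟨?_, fun h => ⟨0, 1, h⟩⟩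
    rintro ⟨i, j, h⟩ h0
    refine h ?_
    change (u 0).1 * (u 1).2 - (u 0).2 * (u 1).1 = 0 at h0
    fin_cases i <;> fin_cases j
    · simp only [Fin.zero_eta]; ring
    · exact h0
    · simp only [Fin.zero_eta, Fin.mk_one]; linear_combination -h0
    · simp only [Fin.mk_one]; ring

/-- The structure on a group `G = H / N`, with `N` central in `H` and of order `p`, that comes from
commutators of lifts: for commuting `x`, `y` in `G`, the commutator of lifts to `H` is an element
`form x y` of `N ≅ ZMod p`. The last three fields say that a commuting pair with a given nonzero
form is unique up to conjugation, that only elements of the central subgroup `rad` commute with such a pair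
and pair trivially with it, and that such pairs exist. -/
structure CommutatorPairing (G : Type) [Group G] (p : ℕ) where
  /-- The class of the commutator of lifts; meaningful for commuting elements only. -/
  form : G → G → ZMod p
  /-- The image in `G` of the centre of `H`. -/
  rad : Subgroup G
  rad_le_center : rad ≤ Subgroup.center G
  form_self (x : G) : form x x = 0
  form_swap {x y : G} : Commute x y → form y x = -form x y
  form_mul {x y z : G} : Commute x z → Commute y z → form (x * y) z = form x z + form y z
  form_conj {x y : G} (g : G) : Commute x y → form (g * x * g⁻¹) (g * y * g⁻¹) = form x y
  form_rad {k : G} (x : G) : k ∈ rad → form k x = 0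
  exists_conj {x y x' y' : G} : Commute x y → Commute x' y' → form x y ≠ 0 →
    form x' y' = form x y → ∃ g : G, g * x * g⁻¹ = x' ∧ g * y * g⁻¹ = y'
  mem_rad {x y w : G} : Commute x y → form x y ≠ 0 → Commute w x → Commute w y →
    form w x = 0 → form w y = 0 → w ∈ rad
  exists_form_eq_one : ∃ a b : G, Commute a b ∧ form a b = 1

namespace CommutatorPairing

variable {G : Type} [Group G] {p : ℕ} (P : CommutatorPairing G p) {x y z w : G}

theorem form_one_left (z : G) : P.form 1 z = 0 := P.form_rad z (one_mem _)

theorem form_inv (hx : Commute x z) : P.form x⁻¹ z = -P.form x z := by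
  have := P.form_mul hx.inv_left hx
  rw [inv_mul_cancel, P.form_one_left] at this
  exact eq_neg_of_add_eq_zero_left this.symm

theorem form_pow (hx : Commute x z) (n : ℕ) : P.form (x ^ n) z = n * P.form x z := by
  induction n with
  | zero => simp [P.form_one_left]
  | succ n ih => rw [pow_succ, P.form_mul (hx.pow_left n) hx, ih]; push_cast; ring

theorem commute_of_mem_rad {k : G} (hk : k ∈ P.rad) (x : G) : Commute k x :=
  ((Subgroup.mem_center_iff.1 (P.rad_le_center hk) x).symm :)

theorem form_word [NeZero p] {k : G} (hk : k ∈ P.rad) (r s : ZMod p)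
    (hwx : Commute w x) (hwy : Commute w y) :
    P.form (k * (x ^ r.val * y ^ s.val)) w = r * P.form x w + s * P.form y w := by
  have hx := hwx.symm.pow_left r.val
  have hy := hwy.symm.pow_left s.val
  rw [P.form_mul (P.commute_of_mem_rad hk w) (hx.mul_left hy), P.form_rad _ hk,
    P.form_mul hx hy, P.form_pow hwx.symm, P.form_pow hwy.symm, ZMod.natCast_zmod_val,
    ZMod.natCast_zmod_val, zero_add]

/-- An element commuting with a pair of nonzero form is a word in that pair, up to the radical. -/
theorem exists_eq_word [Fact p.Prime] (hxy : Commute x y) (h0 : P.form x y ≠ 0)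
    (hwx : Commute w x) (hwy : Commute w y) :
    w * (x ^ (P.form w y / P.form x y).val * y ^ (P.form x w / P.form x y).val)⁻¹ ∈ P.rad := by
  set r := P.form w y / P.form x y
  set s := P.form x w / P.form x y
  have cx : Commute (x ^ r.val * y ^ s.val) x :=
    ((Commute.refl x).pow_left _).mul_left (hxy.symm.pow_left _)
  have cy : Commute (x ^ r.val * y ^ s.val) y :=
    (hxy.pow_left _).mul_left ((Commute.refl y).pow_left _)
  have hword (v : G) (hv : Commute v x) (hv' : Commute v y) := by
    have := P.form_word (one_mem _) r s hv hv'
    rwa [one_mul] at this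
  refine P.mem_rad hxy h0 (hwx.mul_left cx.inv_left) (hwy.mul_left cy.inv_left) ?_ ?_
  · rw [P.form_mul hwx cx.inv_left, P.form_inv cx, hword x (Commute.refl x) hxy, P.form_self,
      P.form_swap hxy, P.form_swap hwx.symm, mul_zero, zero_add, mul_neg, neg_neg,
      div_mul_cancel₀ _ h0, neg_add_cancel]
  · rw [P.form_mul hwy cy.inv_left, P.form_inv cy, hword y hxy.symm (Commute.refl y), P.form_self,
      mul_zero, add_zero, div_mul_cancel₀ _ h0, add_neg_cancel]

theorem commute_of_commute_pair [Fact p.Prime] (hxy : Commute x y) (h0 : P.form x y ≠ 0)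
    (hwx : Commute w x) (hwy : Commute w y) (hzx : Commute z x) (hzy : Commute z y) :
    Commute w z := by
  have h := P.commute_of_mem_rad (P.exists_eq_word hxy h0 hwx hwy) z
  have h2 : Commute (x ^ (P.form w y / P.form x y).val * y ^ (P.form x w / P.form x y).val) z :=
    (hzx.symm.pow_left _).mul_left (hzy.symm.pow_left _)
  have h3 := h.mul_left h2
  rwa [inv_mul_cancel_right] at h3

section Centralizer

variable (a b : G)

/-- The elements commuting with both `a` and `b`. -/
def pairCentralizer : Subgroup G := Subgroup.centralizer {a, b}

variable {a b}

theorem mem_pairCentralizer : w ∈ pairCentralizer a b ↔ Commute w a ∧ Commute w b := by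
  rw [pairCentralizer, Subgroup.mem_centralizer_iff]
  simp only [Set.mem_insert_iff, Set.mem_singleton_iff, forall_eq_or_imp, forall_eq]
  exact and_congr eq_comm eq_comm

/-- Coordinates on the centralizer of a pair of form `1`. -/
def pairCentralizerEquiv [Fact p.Prime] (hab : Commute a b) (h1 : P.form a b = 1) :
    pairCentralizer a b ≃ P.rad × (ZMod p × ZMod p) where
  toFun w := (⟨w * (a ^ (P.form w b).val * b ^ (P.form a w).val)⁻¹, by
    have h := mem_pairCentralizer.1 w.2
    simpa [h1] using P.exists_eq_word hab (h1 ▸ one_ne_zero) h.1 h.2⟩, (P.form w b, P.form a w))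
  invFun u := ⟨u.1 * (a ^ u.2.1.val * b ^ u.2.2.val), mem_pairCentralizer.2
    ⟨(P.commute_of_mem_rad u.1.2 a).mul_left
      (((Commute.refl a).pow_left _).mul_left (hab.symm.pow_left _)),
    (P.commute_of_mem_rad u.1.2 b).mul_left
      ((hab.pow_left _).mul_left ((Commute.refl b).pow_left _))⟩⟩
  left_inv w := Subtype.ext (inv_mul_cancel_right _ _)
  right_inv := by
    rintro ⟨⟨k, hk⟩, r, s⟩
    have ha : P.form (k * (a ^ r.val * b ^ s.val)) b = r := by
      rw [P.form_word hk r s hab.symm (Commute.refl b), h1, P.form_self, mul_zero, mul_one,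
        add_zero]
    have hb : P.form a (k * (a ^ r.val * b ^ s.val)) = s := by
      rw [P.form_swap (x := k * (a ^ r.val * b ^ s.val)),
        P.form_word hk r s (Commute.refl a) hab, P.form_self, P.form_swap hab, h1]
      · ring
      · exact (P.commute_of_mem_rad hk a).mul_left
          (((Commute.refl a).pow_left _).mul_left (hab.symm.pow_left _))
    simp only [ha, hb, mul_inv_cancel_right]

theorem form_eq_det [Fact p.Prime] (hab : Commute a b) (h1 : P.form a b = 1)
    (hw : w ∈ pairCentralizer a b) (hz : z ∈ pairCentralizer a b) :
    P.form w z = P.form w b * P.form a z - P.form a w * P.form z b := by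
  rw [mem_pairCentralizer] at hw hz
  have hk := P.exists_eq_word hab (h1 ▸ one_ne_zero) hw.1 hw.2
  have h := P.form_word hk (P.form w b / P.form a b) (P.form a w / P.form a b) hz.1 hz.2
  rw [inv_mul_cancel_right, h1, div_one, div_one] at h
  rw [h, P.form_swap hz.2]
  ring

end Centralizer

/-- A commuting tuple is nondegenerate if lifts of its entries do not all commute. -/
def Nondegenerate {n : ℕ} (x : HomZ n G) : Prop := ∃ i j, P.form (x.1 i) (x.1 j) ≠ 0

/-- The conjugation classes of nondegenerate commuting tuples. -/
def nondegenerateClasses (n : ℕ) : Set (RepZ n G) :=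
  {o | ∃ x : HomZ n G, ⟦x⟧ = o ∧ P.Nondegenerate x}

theorem form_eq_of_mk_eq {n : ℕ} {x y : HomZ n G} (h : (⟦x⟧ : RepZ n G) = ⟦y⟧) (i j : Fin n) :
    P.form (x.1 i) (x.1 j) = P.form (y.1 i) (y.1 j) := by
  obtain ⟨g, hg⟩ := RepZ.mk_eq_mk_iff.1 h
  rw [hg, hg, P.form_conj g (y.2 i j)]

theorem nondegenerate_of_mk_eq {n : ℕ} {x y : HomZ n G} (h : (⟦x⟧ : RepZ n G) = ⟦y⟧)
    (hy : P.Nondegenerate y) : P.Nondegenerate x := by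
  obtain ⟨i, j, hij⟩ := hy
  exact ⟨i, j, by rwa [P.form_eq_of_mk_eq h]⟩

section Counting

variable [Fact p.Prime] {a b : G} (hab : Commute a b) (h1 : P.form a b = 1) (n : ℕ)

/-- Nondegenerate tuples in the centralizer of `a`, `b`. -/
abbrev CentralizerTuples (a b : G) : Type :=
  {e : Fin n → pairCentralizer a b // ∃ i j, P.form (e i) (e j) ≠ 0}

include hab h1 in
theorem card_centralizerTuples :
    Nat.card (P.CentralizerTuples n a b) =
      Nat.card P.rad ^ n * ((p ^ n - 1) * (p ^ n - p)) := by
  have hcount := card_spanning_tuples (ZMod p) n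
  rw [ZMod.card] at hcount
  rw [← hcount, ← Nat.card_fin n, ← Nat.card_fun, Nat.card_fin, ← Nat.card_prod]
  let e1 : (Fin n → pairCentralizer a b) ≃ (Fin n → P.rad) × (Fin n → ZMod p × ZMod p) :=
    (Equiv.arrowCongr (Equiv.refl _) (P.pairCentralizerEquiv hab h1)).trans
      (Equiv.arrowProdEquivProdArrow _ _ _)
  have e2 : P.CentralizerTuples n a b ≃
      {u : (Fin n → P.rad) × (Fin n → ZMod p × ZMod p) //
        ∃ i j, (u.2 i).1 * (u.2 j).2 - (u.2 i).2 * (u.2 j).1 ≠ 0} := by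
    refine e1.subtypeEquiv fun e => exists₂_congr fun i j => ?_
    rw [P.form_eq_det hab h1 (e i).2 (e j).2]
    rfl
  refine Nat.card_congr (e2.trans ?_)
  exact
    { toFun := fun u => (u.1.1, ⟨u.1.2, u.2⟩)
      invFun := fun u => ⟨(u.1, u.2.1), u.2.2⟩
      left_inv := fun _ => rfl
      right_inv := fun _ => rfl }

include hab h1 in
theorem card_centralizerPairs {t : ZMod p} (ht : t ≠ 0) :
    Nat.card {z : pairCentralizer a b × pairCentralizer a b // P.form z.1 z.2 = t} * (p - 1) =
      Nat.card P.rad ^ 2 * ((p ^ 2 - 1) * (p ^ 2 - p)) := by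
  have hcount := card_det_eq ht
  rw [ZMod.card] at hcount
  rw [← hcount, ← mul_assoc, pow_two, ← Nat.card_prod, ← Nat.card_prod]
  congr 1
  let e := P.pairCentralizerEquiv hab h1
  have e2 : {z : pairCentralizer a b × pairCentralizer a b // P.form z.1 z.2 = t} ≃
      {u : (P.rad × (ZMod p × ZMod p)) × (P.rad × (ZMod p × ZMod p)) //
        u.1.2.1 * u.2.2.2 - u.1.2.2 * u.2.2.1 = t} := by
    refine (Equiv.prodCongr e e).subtypeEquiv fun z => ?_
    rw [P.form_eq_det hab h1 z.1.2 z.2.2]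
    rfl
  refine Nat.card_congr (e2.trans ?_)
  exact
    { toFun := fun u => ((u.1.1.1, u.1.2.1), ⟨(u.1.1.2, u.1.2.2), u.2⟩)
      invFun := fun u => ⟨((u.1.1, u.2.1.1), (u.1.2, u.2.1.2)), u.2.2⟩
      left_inv := fun _ => rfl
      right_inv := fun _ => rfl }

include hab h1 in
theorem commute_of_mem_pairCentralizer (hw : w ∈ pairCentralizer a b)
    (hz : z ∈ pairCentralizer a b) : Commute w z := by
  rw [mem_pairCentralizer] at hw hz
  exact P.commute_of_commute_pair hab (h1 ▸ one_ne_zero) hw.1 hw.2 hz.1 hz.2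

/-- A tuple in the centralizer of `a`, `b`, as a point of `Hom(ℤⁿ, G)`. -/
def centralizerTuple (e : Fin n → pairCentralizer a b) : HomZ n G :=
  ⟨fun i => e i, fun i j => P.commute_of_mem_pairCentralizer hab h1 (e i).2 (e j).2⟩

/-- The conjugation class of a nondegenerate tuple in the centralizer of `a`, `b`. -/
def centralizerTupleClass (e : P.CentralizerTuples n a b) : P.nondegenerateClasses n :=
  ⟨⟦P.centralizerTuple hab h1 n e.1⟧, _, rfl, e.2⟩

/-- The elements commuting with a pair of nonzero form in the centralizer of `a`, `b` are those of
this centralizer. -/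
theorem mem_pairCentralizer_of_commute (hx : x ∈ pairCentralizer a b)
    (hy : y ∈ pairCentralizer a b) (h0 : P.form x y ≠ 0)
    (hxy : Commute x y) (hwx : Commute w x) (hwy : Commute w y) : w ∈ pairCentralizer a b := by
  rw [mem_pairCentralizer] at hx hy ⊢
  exact ⟨P.commute_of_commute_pair hxy h0 hwx hwy hx.1.symm hy.1.symm,
    P.commute_of_commute_pair hxy h0 hwx hwy hx.2.symm hy.2.symm⟩

theorem centralizerTupleClass_surjective :
    Function.Surjective (P.centralizerTupleClass hab h1 n) := by
  rintro ⟨_, x, rfl, i, j, hij⟩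
  -- A power of `b` adjusts the form of the pair `a`, `b` to that of `x i`, `x j`.
  set t := P.form (x.1 i) (x.1 j) with ht
  have hab' : Commute a (b ^ t.val) := hab.pow_right _
  have hform : P.form a (b ^ t.val) = t := by
    rw [P.form_swap hab'.symm, P.form_pow hab.symm, P.form_swap hab, h1, ZMod.natCast_zmod_val]
    ring
  obtain ⟨g, hgi, hgj⟩ := P.exists_conj (x.2 i j) hab' hij (hform.trans ht)
  have hcomm (k l) : Commute (g * x.1 k * g⁻¹) (g * x.1 l * g⁻¹) := by
    simpa using (x.2 k l).map (MulAut.conj g)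
  have ha : a ∈ pairCentralizer a b := mem_pairCentralizer.2 ⟨Commute.refl a, hab⟩
  have hb : b ^ t.val ∈ pairCentralizer a b :=
    mem_pairCentralizer.2 ⟨hab'.symm, (Commute.refl b).pow_left _⟩
  have hmem (k) : g * x.1 k * g⁻¹ ∈ pairCentralizer a b := by
    refine P.mem_pairCentralizer_of_commute ha hb (hform.symm ▸ hij) hab' ?_ ?_
    · rw [← hgi]; exact hcomm k i
    · rw [← hgj]; exact hcomm k j
  refine ⟨⟨fun k => ⟨_, hmem k⟩, i, j, ?_⟩, ?_⟩
  · rw [P.form_conj g (x.2 i j)]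
    exact hij
  · exact Subtype.ext (RepZ.mk_eq_mk_iff.2 ⟨g, fun k => rfl⟩)

/-- The tuples in one class correspond to the pairs in the centralizer of `a`, `b` of a fixed nonzero
form `t`: a conjugation moving one pair of form `t` to another is determined by this up to
elements of the centralizer, which is abelian. -/
theorem card_fiber (o : P.nondegenerateClasses n) : ∃ t : ZMod p, t ≠ 0 ∧
    Nat.card {e // P.centralizerTupleClass hab h1 n e = o} =
      Nat.card {z : pairCentralizer a b × pairCentralizer a b // P.form z.1 z.2 = t} := by
  obtain ⟨s, rfl⟩ := P.centralizerTupleClass_surjective hab h1 n o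
  obtain ⟨i, j, hij⟩ := s.2
  refine ⟨_, hij, Nat.card_eq_of_bijective (fun e => ⟨(e.1.1 i, e.1.1 j),
    P.form_eq_of_mk_eq (congrArg Subtype.val e.2) i j⟩) ⟨?_, ?_⟩⟩
  · rintro ⟨e, he⟩ ⟨f, hf⟩ hef
    obtain ⟨hi, hj⟩ := Prod.ext_iff.1 (congrArg Subtype.val hef)
    simp only at hi hj
    obtain ⟨g, hg⟩ := RepZ.mk_eq_mk_iff.1 (congrArg Subtype.val (he.trans hf.symm))
    change ∀ k, (e.1 k : G) = g * f.1 k * g⁻¹ at hg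
    have hfij : P.form (f.1 i) (f.1 j) ≠ 0 := by
      have := P.form_eq_of_mk_eq (congrArg Subtype.val hf) i j
      exact this.symm ▸ hij
    have hgf (k) (hk : e.1 k = f.1 k) : Commute g (f.1 k : G) := by
      have := hg k
      rw [hk, eq_mul_inv_iff_mul_eq] at this
      exact this.symm
    have hgE := P.mem_pairCentralizer_of_commute (f.1 i).2 (f.1 j).2 hfij
      (P.commute_of_mem_pairCentralizer hab h1 (f.1 i).2 (f.1 j).2) (hgf i hi) (hgf j hj)
    refine Subtype.ext (Subtype.ext (funext fun k => Subtype.ext ?_))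
    rw [hg k, (P.commute_of_mem_pairCentralizer hab h1 hgE (f.1 k).2).eq, mul_inv_cancel_right]
  · rintro ⟨⟨u, v⟩, huv⟩
    change P.form u v = P.form (s.1 i) (s.1 j) at huv
    have hc {w z : G} (hw : w ∈ pairCentralizer a b) (hz : z ∈ pairCentralizer a b) :
        Commute w z := P.commute_of_mem_pairCentralizer hab h1 hw hz
    obtain ⟨g, hgi, hgj⟩ := P.exists_conj (hc (s.1 i).2 (s.1 j).2) (hc u.2 v.2) hij huv
    have hcomm (k l) : Commute (g * s.1 k * g⁻¹) (g * s.1 l * g⁻¹) := by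
      simpa using (hc (s.1 k).2 (s.1 l).2).map (MulAut.conj g)
    have hmem (k) : g * s.1 k * g⁻¹ ∈ pairCentralizer a b := by
      refine P.mem_pairCentralizer_of_commute u.2 v.2 (huv.symm ▸ hij) (hc u.2 v.2) ?_ ?_
      · rw [← hgi]; exact hcomm k i
      · rw [← hgj]; exact hcomm k j
    refine ⟨⟨⟨fun k => ⟨_, hmem k⟩, i, j, ?_⟩, ?_⟩, ?_⟩
    · rw [P.form_conj g (hc (s.1 i).2 (s.1 j).2)]
      exact hij
    · exact Subtype.ext (RepZ.mk_eq_mk_iff.2 ⟨g, fun k => rfl⟩)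
    · exact Subtype.ext (Prod.ext (Subtype.ext hgi) (Subtype.ext hgj))

end Counting

/-- The nondegenerate classes are counted by the nondegenerate tuples in the centralizer of a
fixed pair of form `1`: the classes are covered evenly by them. -/
theorem finite_and_card_nondegenerateClasses [hp : Fact p.Prime] [Finite P.rad] (n : ℕ) :
    (P.nondegenerateClasses n).Finite ∧
      Nat.card (P.nondegenerateClasses n) * (Nat.card P.rad ^ 2 * (p * (p ^ 2 - 1))) =
        Nat.card P.rad ^ n * ((p ^ n - 1) * (p ^ n - p)) := by
  obtain ⟨a, b, hab, h1⟩ := P.exists_form_eq_one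
  have : Finite (pairCentralizer a b) := Finite.of_equiv _ (P.pairCentralizerEquiv hab h1).symm
  have hfin : Finite (P.nondegenerateClasses n) :=
    Finite.of_surjective _ (P.centralizerTupleClass_surjective hab h1 n)
  refine ⟨hfin, ?_⟩
  have := Fintype.ofFinite (P.nondegenerateClasses n)
  rw [← P.card_centralizerTuples hab h1 n,
    Nat.card_congr (Equiv.sigmaFiberEquiv (P.centralizerTupleClass hab h1 n)).symm, Nat.card_sigma]
  have hfib (o : P.nondegenerateClasses n) :
      Nat.card {e // P.centralizerTupleClass hab h1 n e = o} =
        Nat.card P.rad ^ 2 * (p * (p ^ 2 - 1)) := by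
    obtain ⟨t, ht, h⟩ := P.card_fiber hab h1 n o
    have h2 := P.card_centralizerPairs hab h1 ht
    rw [h]
    have hp1 : 0 < p - 1 := Nat.sub_pos_of_lt hp.out.one_lt
    refine Nat.eq_of_mul_eq_mul_right hp1 (h2.trans ?_)
    have : p ^ 2 - p = p * (p - 1) := by rw [Nat.mul_sub, mul_one, pow_two]
    rw [this]
    ring
  rw [Finset.sum_congr rfl fun o _ => hfib o, Finset.sum_const, Finset.card_univ,
    Nat.card_eq_fintype_card, smul_eq_mul]

end CommutatorPairing

/-! ### The commutator pairing of `G_{m,p}` -/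

section Lifts

variable {m p : ℕ}

/-- The scalar matrix of a `p`-th root of unity. -/
noncomputable def scalarSU (p : ℕ) [NeZero p] (t : ZMod p) : SU p :=
  ⟨Matrix.scalar (Fin p) (ZMod.stdAddChar t), by
    have hp : (ZMod.stdAddChar t : ℂ) ^ p = 1 := by
      rw [← AddChar.map_nsmul_eq_pow, nsmul_eq_mul, CharP.cast_eq_zero, zero_mul,
        AddChar.map_zero_eq_one]
    rw [Matrix.mem_specialUnitaryGroup_iff, Matrix.mem_unitaryGroup_iff, Matrix.scalar_apply,
      Matrix.det_diagonal, Matrix.star_eq_conjTranspose, Matrix.diagonal_conjTranspose,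
      Matrix.diagonal_mul_diagonal, ← Matrix.diagonal_one]
    refine ⟨?_, by simpa using hp⟩
    congr 1
    ext j
    have h := Complex.mul_conj' (ZMod.stdAddChar t : ℂ)
    rw [Complex.norm_eq_one_of_pow_eq_one hp (NeZero.ne p)] at h
    simpa using h⟩

theorem coe_scalarSU [NeZero p] (t : ZMod p) :
    (scalarSU p t : Matrix (Fin p) (Fin p) ℂ) = Matrix.scalar (Fin p) (ZMod.stdAddChar t) := rfl

theorem scalarSU_injective [NeZero p] : Function.Injective (scalarSU p) := fun s t h => by
  have := congrArg (fun A : SU p => (A : Matrix (Fin p) (Fin p) ℂ)) h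
  exact ZMod.injective_stdAddChar (Matrix.scalar_inj.1 this)

theorem scalarSU_add [NeZero p] (s t : ZMod p) :
    scalarSU p (s + t) = scalarSU p s * scalarSU p t := by
  apply Subtype.ext
  rw [SU.coe_mul, coe_scalarSU, coe_scalarSU, coe_scalarSU, AddChar.map_add_eq_mul, map_mul]

theorem scalarSU_commute [NeZero p] (t : ZMod p) (A : SU p) : Commute (scalarSU p t) A :=
  Subtype.ext (Matrix.scalar_commute _ (fun r => Commute.all _ r) _).eq

theorem isPrimitiveRoot_stdAddChar [hp : Fact p.Prime] {t : ZMod p} (ht : t ≠ 0) :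
    IsPrimitiveRoot (ZMod.stdAddChar t : ℂ) p := by
  have h : orderOf (ZMod.stdAddChar t : ℂ) = p := by
    refine orderOf_eq_prime ?_ fun h => ht (ZMod.injective_stdAddChar ?_)
    · rw [← AddChar.map_nsmul_eq_pow, nsmul_eq_mul, CharP.cast_eq_zero, zero_mul,
        AddChar.map_zero_eq_one]
    · rw [h, AddChar.map_zero_eq_one]
  exact IsPrimitiveRoot.iff_orderOf.2 h

theorem exists_eq_scalarSU [hp : Fact p.Prime] {A : SU p} {z : ℂ}
    (h : (A : Matrix (Fin p) (Fin p) ℂ) = Matrix.scalar (Fin p) z) :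
    ∃ t, ZMod.stdAddChar t = z ∧ A = scalarSU p t := by
  have hdet := (Matrix.mem_specialUnitaryGroup_iff.1 A.2).2
  rw [h, Matrix.scalar_apply, Matrix.det_diagonal, Finset.prod_const, Finset.card_univ,
    Fintype.card_fin] at hdet
  obtain ⟨i, -, hi⟩ := (isPrimitiveRoot_stdAddChar (p := p) one_ne_zero).eq_pow_of_pow_eq_one hdet
  have : ZMod.stdAddChar (i : ZMod p) = z := by
    rw [← hi, ← AddChar.map_nsmul_eq_pow, nsmul_one]
  exact ⟨i, this, Subtype.ext (by rw [h, coe_scalarSU, this])⟩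

/-- The generator of `Δ(ℤ/p)` indexed by `t`. -/
noncomputable def diagScalar (m p : ℕ) [NeZero p] (t : ZMod p) : Fin m → SU p :=
  fun _ => scalarSU p t

theorem diagScalar_mem [NeZero p] (t : ZMod p) : diagScalar m p t ∈ diagCenter m p :=
  ⟨_, fun _ => coe_scalarSU t⟩

theorem diagScalar_commute [NeZero p] (t : ZMod p) (A : Fin m → SU p) :
    Commute (diagScalar m p t) A := funext fun _ => scalarSU_commute t _

theorem diagScalar_add [NeZero p] (s t : ZMod p) :
    diagScalar m p (s + t) = diagScalar m p s * diagScalar m p t :=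
  funext fun _ => scalarSU_add s t

theorem diagScalar_zero [NeZero p] : diagScalar m p 0 = 1 := by
  have := diagScalar_add (m := m) (p := p) 0 0
  rwa [add_zero, left_eq_mul] at this

theorem diagScalar_injective [NeZero m] [NeZero p] : Function.Injective (diagScalar m p) :=
  fun _ _ h => scalarSU_injective (congrFun h 0)

theorem mem_diagCenter_iff [NeZero m] [Fact p.Prime] {A : Fin m → SU p} :
    A ∈ diagCenter m p ↔ ∃ t, A = diagScalar m p t := by
  constructor
  · rintro ⟨z, hz⟩
    obtain ⟨t, ht, -⟩ := exists_eq_scalarSU (hz 0)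
    exact ⟨t, funext fun k => Subtype.ext (by rw [hz k, ← ht]; rfl)⟩
  · rintro ⟨t, rfl⟩
    exact diagScalar_mem t

/-- `A` and `B` commute up to the element of `Δ(ℤ/p)` indexed by `t`. -/
def TwistedCommute [NeZero p] (t : ZMod p) (A B : Fin m → SU p) : Prop :=
  A * B = diagScalar m p t * (B * A)

namespace TwistedCommute

variable [NeZero p] {s t : ZMod p} {A B C : Fin m → SU p}

theorem mul (h : TwistedCommute s A C) (h' : TwistedCommute t B C) :
    TwistedCommute (s + t) (A * B) C := by
  unfold TwistedCommute at *
  rw [mul_assoc, h', ← mul_assoc, ← (diagScalar_commute t A).eq, mul_assoc, ← mul_assoc A, h,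
    ← mul_assoc, ← mul_assoc, ← diagScalar_add, add_comm t, mul_assoc, mul_assoc]

theorem symm (h : TwistedCommute t A B) : TwistedCommute (-t) B A := by
  unfold TwistedCommute at *
  rw [h, ← mul_assoc, ← diagScalar_add, neg_add_cancel, diagScalar_zero, one_mul]

theorem conj (g : Fin m → SU p) (h : TwistedCommute t A B) :
    TwistedCommute t (g * A * g⁻¹) (g * B * g⁻¹) := by
  unfold TwistedCommute at *
  calc g * A * g⁻¹ * (g * B * g⁻¹) = g * (A * B) * g⁻¹ := by group
    _ = diagScalar m p t * (g * (B * A) * g⁻¹) := by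
      rw [h, ← mul_assoc g, ← (diagScalar_commute t g).eq]; group
    _ = _ := by group

theorem _root_.twistedCommute_zero : TwistedCommute 0 A B ↔ Commute A B := by
  rw [TwistedCommute, diagScalar_zero, one_mul]
  rfl

theorem unique [NeZero m] (h : TwistedCommute s A B) (h' : TwistedCommute t A B) : s = t :=
  diagScalar_injective (mul_right_cancel (Eq.trans (Eq.symm h) h'))

theorem apply (h : TwistedCommute t A B) (k : Fin m) :
    (A k : Matrix (Fin p) (Fin p) ℂ) * B k =
      (ZMod.stdAddChar t : ℂ) • ((B k : Matrix (Fin p) (Fin p) ℂ) * A k) := by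
  have := congrArg (fun X : SU p => (X : Matrix (Fin p) (Fin p) ℂ)) (congrFun h k)
  refine this.trans ?_
  change Matrix.scalar (Fin p) _ * _ = _
  rw [Matrix.scalar_apply, Matrix.smul_eq_diagonal_mul]
  rfl

end TwistedCommute

variable [Fact p.Prime]

variable (m p) in
/-- The centre of `SU(p)^m`: the tuples of scalar matrices. -/
def scalarTuples : Subgroup (Fin m → SU p) where
  carrier := {A | ∀ k, ∃ t, A k = scalarSU p t}
  one_mem' k := ⟨0, (congrFun (diagScalar_zero (m := m)) k).symm⟩
  mul_mem' {A B} hA hB k := by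
    obtain ⟨s, hs⟩ := hA k
    obtain ⟨t, ht⟩ := hB k
    exact ⟨s + t, by rw [scalarSU_add, ← hs, ← ht]; rfl⟩
  inv_mem' {A} hA k := by
    obtain ⟨s, hs⟩ := hA k
    refine ⟨-s, inv_eq_of_mul_eq_one_right ?_⟩
    rw [hs, ← scalarSU_add, add_neg_cancel]
    exact congrFun (diagScalar_zero (m := m)) k

theorem commute_of_mem_scalarTuples {A : Fin m → SU p} (hA : A ∈ scalarTuples m p)
    (B : Fin m → SU p) : Commute A B := funext fun k => by
  obtain ⟨t, ht⟩ := hA k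
  rw [Pi.mul_apply, Pi.mul_apply, ht]
  exact scalarSU_commute t (B k)

variable [NeZero m]

theorem twistedCommute_of_mk_eq {t : ZMod p} {A B A' B' : Fin m → SU p}
    (hA : (A : CentralProd m p) = A') (hB : (B : CentralProd m p) = B')
    (h : TwistedCommute t A B) : TwistedCommute t A' B' := by
  obtain ⟨r, hr⟩ := mem_diagCenter_iff.1 (QuotientGroup.eq.1 hA)
  obtain ⟨s, hs⟩ := mem_diagCenter_iff.1 (QuotientGroup.eq.1 hB)
  obtain rfl : A' = diagScalar m p r * A := by
    rw [(diagScalar_commute r A).eq, ← hr, mul_inv_cancel_left]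
  obtain rfl : B' = diagScalar m p s * B := by
    rw [(diagScalar_commute s B).eq, ← hs, mul_inv_cancel_left]
  have h1 (X Y : Fin m → SU p) (q : ZMod p) : TwistedCommute 0 (diagScalar m p q * X) Y ↔
      TwistedCommute 0 X Y := by
    rw [twistedCommute_zero, twistedCommute_zero]
    refine ⟨fun h => ?_, fun h => (diagScalar_commute q Y).mul_left h⟩
    simpa using (diagScalar_commute q Y).inv_left.mul_left h
  have hr0 (q) (Y : Fin m → SU p) : TwistedCommute 0 (diagScalar m p q) Y :=
    twistedCommute_zero.2 (diagScalar_commute q Y)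
  have h2 := (hr0 r (diagScalar m p s * B)).mul (((hr0 s A).mul h.symm).symm)
  simpa using h2

theorem commute_mk_iff {A B : Fin m → SU p} :
    Commute (A : CentralProd m p) B ↔ ∃ t, TwistedCommute t A B := by
  constructor
  · intro h
    have h' : ((B * A : Fin m → SU p) : CentralProd m p) = ((A * B : Fin m → SU p) :) := h.symm.eq
    obtain ⟨t, ht⟩ := mem_diagCenter_iff.1 (QuotientGroup.eq.1 h')
    refine ⟨t, ?_⟩
    rw [TwistedCommute, (diagScalar_commute t _).eq, ← ht, mul_inv_cancel_left]
  · rintro ⟨t, ht⟩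
    have : ((A * B : Fin m → SU p) : CentralProd m p) = ((B * A : Fin m → SU p) :) := by
      rw [eq_comm, QuotientGroup.eq, ht, (diagScalar_commute t _).eq, inv_mul_cancel_left]
      exact diagScalar_mem t
    exact this

open Classical in
/-- The class in `ZMod p ≅ Δ(ℤ/p)` of the commutator of lifts of `x` and `y` (and `0` if `x` and `y`
do not commute). -/
noncomputable def commutatorForm (x y : CentralProd m p) : ZMod p :=
  if h : ∃ t, TwistedCommute t x.out y.out then h.choose else 0

theorem commutatorForm_mk {t : ZMod p} {A B : Fin m → SU p} (h : TwistedCommute t A B) :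
    commutatorForm (A : CentralProd m p) B = t := by
  have h' := twistedCommute_of_mk_eq (QuotientGroup.out_eq' (A : CentralProd m p)).symm
    (QuotientGroup.out_eq' (B : CentralProd m p)).symm h
  have hex : ∃ t, TwistedCommute t (Quotient.out (A : CentralProd m p))
    (Quotient.out (B : CentralProd m p)) := ⟨t, h'⟩
  rw [commutatorForm, dif_pos hex]
  exact hex.choose_spec.unique h'

variable (m p) in
/-- The commutator pairing of the central product. -/
noncomputable def centralProdPairing : CommutatorPairing (CentralProd m p) p where
  form := commutatorForm
  rad := (scalarTuples m p).map (QuotientGroup.mk' (diagCenter m p))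
  rad_le_center := by
    rintro _ ⟨A, hA, rfl⟩
    rw [Subgroup.mem_center_iff]
    intro g
    obtain ⟨B, rfl⟩ := QuotientGroup.mk_surjective g
    exact (commute_mk_iff.2 ⟨0, twistedCommute_zero.2 (commute_of_mem_scalarTuples hA B)⟩).symm
  form_self x := by
    obtain ⟨A, rfl⟩ := QuotientGroup.mk_surjective x
    exact commutatorForm_mk (twistedCommute_zero.2 (Commute.refl A))
  form_swap {x y} h := by
    obtain ⟨A, rfl⟩ := QuotientGroup.mk_surjective x
    obtain ⟨B, rfl⟩ := QuotientGroup.mk_surjective y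
    obtain ⟨t, ht⟩ := commute_mk_iff.1 h
    rw [commutatorForm_mk ht, commutatorForm_mk ht.symm]
  form_mul {x y z} hx hy := by
    obtain ⟨A, rfl⟩ := QuotientGroup.mk_surjective x
    obtain ⟨B, rfl⟩ := QuotientGroup.mk_surjective y
    obtain ⟨C, rfl⟩ := QuotientGroup.mk_surjective z
    obtain ⟨s, hs⟩ := commute_mk_iff.1 hx
    obtain ⟨t, ht⟩ := commute_mk_iff.1 hy
    rw [commutatorForm_mk hs, commutatorForm_mk ht, ← QuotientGroup.mk_mul,
      commutatorForm_mk (hs.mul ht)]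
  form_conj {x y} g h := by
    obtain ⟨A, rfl⟩ := QuotientGroup.mk_surjective x
    obtain ⟨B, rfl⟩ := QuotientGroup.mk_surjective y
    obtain ⟨g, rfl⟩ := QuotientGroup.mk_surjective g
    obtain ⟨t, ht⟩ := commute_mk_iff.1 h
    rw [commutatorForm_mk ht]
    exact commutatorForm_mk (ht.conj g)
  form_rad {k} x hk := by
    obtain ⟨A, hA, rfl⟩ := hk
    obtain ⟨B, rfl⟩ := QuotientGroup.mk_surjective x
    exact commutatorForm_mk (twistedCommute_zero.2 (commute_of_mem_scalarTuples hA B))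
  exists_conj {x y x' y'} h h' h0 heq := by
    obtain ⟨A, rfl⟩ := QuotientGroup.mk_surjective x
    obtain ⟨B, rfl⟩ := QuotientGroup.mk_surjective y
    obtain ⟨A', rfl⟩ := QuotientGroup.mk_surjective x'
    obtain ⟨B', rfl⟩ := QuotientGroup.mk_surjective y'
    obtain ⟨t, ht⟩ := commute_mk_iff.1 h
    obtain ⟨t', ht'⟩ := commute_mk_iff.1 h'
    rw [commutatorForm_mk ht] at h0 heq
    rw [commutatorForm_mk ht'] at heq
    subst heq
    choose g hgA hgB using fun k =>
      Heisenberg.exists_conj_pair (isPrimitiveRoot_stdAddChar h0) (ht.apply k) (ht'.apply k)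
    refine ⟨(g : Fin m → SU p), ?_, ?_⟩
    · exact congrArg (QuotientGroup.mk (s := diagCenter m p)) (funext hgA : g * A * g⁻¹ = A')
    · exact congrArg (QuotientGroup.mk (s := diagCenter m p)) (funext hgB : g * B * g⁻¹ = B')
  mem_rad {x y w} h h0 hx hy hx0 hy0 := by
    obtain ⟨A, rfl⟩ := QuotientGroup.mk_surjective x
    obtain ⟨B, rfl⟩ := QuotientGroup.mk_surjective y
    obtain ⟨W, rfl⟩ := QuotientGroup.mk_surjective w
    obtain ⟨t, ht⟩ := commute_mk_iff.1 h
    obtain ⟨r, hr⟩ := commute_mk_iff.1 hx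
    obtain ⟨s, hs⟩ := commute_mk_iff.1 hy
    rw [commutatorForm_mk ht] at h0
    rw [commutatorForm_mk hr] at hx0
    rw [commutatorForm_mk hs] at hy0
    subst hx0 hy0
    refine ⟨W, fun k => ?_, rfl⟩
    obtain ⟨d, hd⟩ := Heisenberg.eq_scalar_of_commute (isPrimitiveRoot_stdAddChar h0)
      (SU.star_mul_self (A k)) (SU.star_mul_self (B k)) (ht.apply k) (X := W k)
      (congrArg Subtype.val (congrFun (twistedCommute_zero.1 hr) k))
      (congrArg Subtype.val (congrFun (twistedCommute_zero.1 hs) k))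
    obtain ⟨q, -, hq⟩ := exists_eq_scalarSU hd
    exact ⟨q, hq⟩
  exists_form_eq_one := by
    obtain ⟨A, B, hAB⟩ :=
      Heisenberg.exists_pair (isPrimitiveRoot_stdAddChar (p := p) one_ne_zero)
    have h : TwistedCommute (1 : ZMod p) (fun _ : Fin m => A) (fun _ => B) := by
      refine funext fun k => Subtype.ext (hAB.trans ?_)
      rw [Matrix.smul_eq_diagonal_mul]
      rfl
    exact ⟨_, _, commute_mk_iff.2 ⟨1, h⟩, commutatorForm_mk h⟩

theorem card_centralProdPairing_rad : Nat.card (centralProdPairing m p).rad = p ^ (m - 1) := by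
  let φ := (QuotientGroup.mk' (diagCenter m p)).comp (scalarTuples m p).subtype
  have h1 : Nat.card (scalarTuples m p) = p ^ m := by
    rw [← Nat.card_eq_of_bijective (α := Fin m → ZMod p)
      (fun f => (⟨fun k => scalarSU p (f k), fun k => ⟨f k, rfl⟩⟩ : scalarTuples m p)) ⟨?_, ?_⟩]
    · simp
    · intro f g h
      exact funext fun k => scalarSU_injective (congrFun (congrArg Subtype.val h) k)
    · intro A
      choose f hf using A.2
      exact ⟨f, Subtype.ext (funext fun k => (hf k).symm)⟩
  have h2 : Nat.card φ.ker = p := by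
    rw [← Nat.card_eq_of_bijective (α := ZMod p)
      (fun t => (⟨⟨diagScalar m p t, fun _ => ⟨t, rfl⟩⟩,
        (QuotientGroup.eq_one_iff _).2 (diagScalar_mem t)⟩ : φ.ker)) ⟨?_, ?_⟩]
    · simp
    · intro s t h
      exact diagScalar_injective (congrArg (fun x : φ.ker => (x.1 : Fin m → SU p)) h)
    · rintro ⟨⟨A, hA⟩, h⟩
      obtain ⟨t, rfl⟩ := mem_diagCenter_iff.1 ((QuotientGroup.eq_one_iff _).1 h)
      exact ⟨t, rfl⟩
  have h3 : φ.range = (centralProdPairing m p).rad := by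
    rw [MonoidHom.range_comp, Subgroup.range_subtype]
    rfl
  have h4 := Subgroup.card_eq_card_quotient_mul_card_subgroup φ.ker
  rw [Nat.card_congr (QuotientGroup.quotientKerEquivRange φ).toEquiv, h3, h1, h2] at h4
  refine Nat.eq_of_mul_eq_mul_right (Fact.out : p.Prime).pos (h4.symm.trans ?_)
  rw [← pow_succ, Nat.sub_add_cancel (NeZero.pos m)]

theorem finite_nondegenerateClasses (n : ℕ) :
    ((centralProdPairing m p).nondegenerateClasses n).Finite := by
  have : Finite (centralProdPairing m p).rad := by
    refine Nat.finite_of_card_ne_zero ?_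
    rw [card_centralProdPairing_rad]
    exact pow_ne_zero _ (NeZero.ne p)
  exact ((centralProdPairing m p).finite_and_card_nondegenerateClasses n).1

theorem card_nondegenerateClasses {n : ℕ} (hn : 1 ≤ n) :
    (Nat.card ((centralProdPairing m p).nondegenerateClasses n) : ℚ) = numComp n m p - 1 := by
  have hp := (Fact.out : p.Prime).one_lt
  have : Finite (centralProdPairing m p).rad := by
    refine Nat.finite_of_card_ne_zero ?_
    rw [card_centralProdPairing_rad]
    exact pow_ne_zero _ (NeZero.ne p)
  have h := ((centralProdPairing m p).finite_and_card_nondegenerateClasses n).2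
  rw [card_centralProdPairing_rad] at h
  have h' := congrArg (Nat.cast : ℕ → ℚ) h
  obtain ⟨n, rfl⟩ := Nat.exists_eq_add_of_le' hn
  obtain ⟨m', hm'⟩ := Nat.exists_eq_add_of_le' (NeZero.pos m)
  have e1 : 1 ≤ p ^ 2 := Nat.one_le_pow _ _ hp.le
  have e2 : 1 ≤ p ^ (n + 1) := Nat.one_le_pow _ _ hp.le
  have e3 : p ≤ p ^ (n + 1) := Nat.le_self_pow (by omega) p
  push_cast [Nat.cast_sub e1, Nat.cast_sub e2, Nat.cast_sub e3] at h'
  have hp1 : (1 : ℚ) < p := by exact_mod_cast hp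
  have hp0 : (p : ℚ) ≠ 0 := by positivity
  have hp2 : (p : ℚ) ^ 2 - 1 ≠ 0 := by nlinarith
  have hz : (p : ℚ) ^ (((m : ℤ) - 1) * (((n + 1 : ℕ) : ℤ) - 2)) * ((p : ℚ) ^ (m - 1)) ^ 2 =
      ((p : ℚ) ^ (m - 1)) ^ (n + 1) := by
    rw [← zpow_natCast (p : ℚ) (m - 1), ← zpow_natCast _ 2, ← zpow_natCast _ (n + 1), ← zpow_mul,
      ← zpow_mul, ← zpow_add₀ hp0]
    congr 1
    rw [hm']
    push_cast
    ring
  rw [numComp, add_sub_cancel_right, eq_div_iff hp2]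
  have hz1 : (p : ℚ) ^ (((n + 1 : ℕ) : ℤ) - 1) = p ^ n := by
    rw [← zpow_natCast]
    congr 1
    push_cast
    ring
  rw [hz1, zpow_natCast]
  have hk : ((p : ℚ) ^ (m - 1)) ^ 2 * p ≠ 0 := by positivity
  refine mul_right_cancel₀ hk ?_
  calc _ = (Nat.card ((centralProdPairing m p).nondegenerateClasses (n + 1)) : ℚ) *
        (((p : ℚ) ^ (m - 1)) ^ 2 * (p * (p ^ 2 - 1))) := by ring
    _ = ((p : ℚ) ^ (m - 1)) ^ (n + 1) * ((p ^ (n + 1) - 1) * (p ^ (n + 1) - p)) := h'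
    _ = _ := by rw [← hz]; ring

end Lifts

/-! ### The maximal torus -/

section Torus

variable {m p : ℕ}

theorem Circle.coe_prod {ι : Type} (s : Finset ι) (f : ι → Circle) :
    ((∏ i ∈ s, f i : Circle) : ℂ) = ∏ i ∈ s, (f i : ℂ) := map_prod Circle.coeHom f s

theorem coe_eq_diagonal {A : Fin m → SU p} (hA : A ∈ diagTuples m p) (k : Fin m) :
    (A k : Matrix (Fin p) (Fin p) ℂ) =
      Matrix.diagonal fun j => (A k : Matrix (Fin p) (Fin p) ℂ) j j :=
  (hA k).diagonal_diag.symm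

theorem norm_diagEntry {A : Fin m → SU p} (hA : A ∈ diagTuples m p) (k : Fin m) (j : Fin p) :
    ‖(A k : Matrix (Fin p) (Fin p) ℂ) j j‖ = 1 := by
  have h := SU.mul_star_self (A k)
  rw [coe_eq_diagonal hA k, Matrix.star_eq_conjTranspose, Matrix.diagonal_conjTranspose,
    Matrix.diagonal_mul_diagonal] at h
  have h1 := congrFun (congrFun h j) j
  rw [Matrix.diagonal_apply_eq, Matrix.one_apply_eq] at h1
  have h2 := Complex.mul_conj' ((A k : Matrix (Fin p) (Fin p) ℂ) j j)
  have h3 := h2.symm.trans h1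
  exact (pow_eq_one_iff_of_nonneg (norm_nonneg _) two_ne_zero).1 (by exact_mod_cast h3)

variable (m p) in
/-- The diagonal entries of a tuple of diagonal matrices. -/
noncomputable def diagEntries : diagTuples m p →* (Fin m → Fin p → Circle) where
  toFun A k j := ⟨(A.1 k : Matrix (Fin p) (Fin p) ℂ) j j,
    mem_sphere_zero_iff_norm.2 (norm_diagEntry A.2 k j)⟩
  map_one' := by
    ext k j
    exact Matrix.one_apply_eq j
  map_mul' A B := by
    ext k j
    change ((A.1 k : Matrix (Fin p) (Fin p) ℂ) * (B.1 k : Matrix (Fin p) (Fin p) ℂ)) j j = _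
    rw [coe_eq_diagonal A.2, Matrix.diagonal_mul]
    rfl

theorem coe_diagEntries (A : diagTuples m p) (k : Fin m) (j : Fin p) :
    (diagEntries m p A k j : ℂ) = (A.1 k : Matrix (Fin p) (Fin p) ℂ) j j := rfl

theorem continuous_diagEntries : Continuous (diagEntries m p) := by
  refine continuous_pi fun k => continuous_pi fun j => continuous_induced_rng.2 ?_
  exact (continuous_subtype_val.comp
    ((continuous_apply k).comp continuous_subtype_val)).matrix_elem j j

theorem prod_diagEntries (A : diagTuples m p) (k : Fin m) : ∏ j, diagEntries m p A k j = 1 := by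
  have hdet := (Matrix.mem_specialUnitaryGroup_iff.1 (A.1 k).2).2
  rw [coe_eq_diagonal A.2, Matrix.det_diagonal] at hdet
  apply Circle.coe_injective
  rw [Circle.coe_prod, Circle.coe_one]
  exact hdet

theorem diagEntries_injective : Function.Injective (diagEntries m p) := by
  intro A B h
  refine Subtype.ext (funext fun k => Subtype.ext ?_)
  rw [coe_eq_diagonal A.2, coe_eq_diagonal B.2]
  congr 1
  ext j
  exact congrArg Circle.coeHom (congrFun (congrFun h k) j)

/-- The tuple of diagonal matrices with given entries, except that in each matrix the entry of
index `0` is adjusted to make the determinant `1`. -/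
noncomputable def torusPoint [NeZero p] (d : Fin m → Fin p → Circle) : diagTuples m p :=
  ⟨fun k => ⟨Matrix.diagonal fun j =>
      ((d k * Pi.mulSingle 0 (∏ i, d k i)⁻¹ : Fin p → Circle) j : ℂ),
    by
      rw [Matrix.mem_specialUnitaryGroup_iff, Matrix.mem_unitaryGroup_iff,
        Matrix.det_diagonal, Matrix.star_eq_conjTranspose, Matrix.diagonal_conjTranspose,
        Matrix.diagonal_mul_diagonal, ← Matrix.diagonal_one]
      constructor
      · congr 1
        ext j
        rw [Pi.star_apply, ← starRingEnd_apply, ← Circle.coe_inv_eq_conj, ← Circle.coe_mul,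
          mul_inv_cancel, Circle.coe_one]
      · rw [← Circle.coe_prod]
        refine congrArg Circle.coeHom (?_ : _ = (1 : Circle))
        simp only [Pi.mul_apply, Finset.prod_mul_distrib, Finset.prod_pi_mulSingle',
          Finset.mem_univ, if_true, mul_inv_cancel]⟩,
    fun k => Matrix.isDiag_diagonal _⟩

theorem diagEntries_torusPoint [NeZero p] (d : Fin m → Fin p → Circle) (k : Fin m) :
    diagEntries m p (torusPoint d) k = d k * Pi.mulSingle 0 (∏ i, d k i)⁻¹ := by
  ext j
  exact Matrix.diagonal_apply_eq _ j

theorem torusPoint_diagEntries [NeZero p] (A : diagTuples m p) :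
    torusPoint (diagEntries m p A) = A := by
  refine diagEntries_injective (funext fun k => ?_)
  rw [diagEntries_torusPoint, prod_diagEntries, inv_one, Pi.mulSingle_one, mul_one]

theorem continuous_torusPoint [NeZero p] :
    Continuous (torusPoint : (Fin m → Fin p → Circle) → diagTuples m p) := by
  refine continuous_induced_rng.2 (continuous_pi fun k => continuous_induced_rng.2 ?_)
  refine Continuous.matrix_diagonal (continuous_pi fun j => continuous_induced_dom.comp ?_)
  have hk : Continuous fun d : Fin m → Fin p → Circle => d k := continuous_apply k
  refine (continuous_apply j).comp (hk.mul ?_)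
  refine (continuous_mulSingle 0).comp (continuous_finsetProd _ fun i _ => ?_).inv
  exact (continuous_apply i).comp hk

theorem torusPoint_surjective [NeZero p] :
    Function.Surjective (torusPoint : (Fin m → Fin p → Circle) → diagTuples m p) :=
  fun A => ⟨_, torusPoint_diagEntries A⟩

instance [NeZero p] : CompactSpace (diagTuples m p) :=
  torusPoint_surjective.compactSpace continuous_torusPoint

instance [NeZero p] : PathConnectedSpace (diagTuples m p) :=
  torusPoint_surjective.pathConnectedSpace continuous_torusPoint

variable (m p) in
/-- The projection from the maximal torus of `SU(p)^m` to that of the quotient. -/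
def torusProj : diagTuples m p →* maxTorus m p :=
  (QuotientGroup.mk' (diagCenter m p)).subgroupMap (diagTuples m p)

theorem continuous_torusProj : Continuous (torusProj m p) :=
  continuous_induced_rng.2 (QuotientGroup.continuous_mk.comp continuous_subtype_val)

theorem torusProj_surjective : Function.Surjective (torusProj m p) :=
  MonoidHom.subgroupMap_surjective _ _

theorem torusProj_eq_one_iff {A : diagTuples m p} :
    torusProj m p A = 1 ↔ A.1 ∈ diagCenter m p := by
  rw [← QuotientGroup.eq_one_iff, Subtype.ext_iff]
  rfl

instance [NeZero p] : CompactSpace (maxTorus m p) :=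
  torusProj_surjective.compactSpace continuous_torusProj

instance [NeZero p] : PathConnectedSpace (maxTorus m p) :=
  torusProj_surjective.pathConnectedSpace continuous_torusProj

instance isClosed_diagCenter [NeZero m] [Fact p.Prime] :
    IsClosed (diagCenter m p : Set (Fin m → SU p)) := by
  have : (diagCenter m p : Set (Fin m → SU p)) = Set.range (diagScalar m p) := by
    ext A
    exact mem_diagCenter_iff.trans (exists_congr fun t => eq_comm)
  rw [this]
  exact (Set.finite_range _).isClosed

theorem Circle.exists_pow_mul_eq_one {n : ℕ} (hn : n ≠ 0) (u : Circle) :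
    ∃ c : Circle, c ^ n * u = 1 := by
  obtain ⟨θ, hθ⟩ := Circle.exp_surjective u⁻¹
  refine ⟨Circle.exp (θ / n), ?_⟩
  have : Circle.exp (θ / n) ^ n = Circle.exp θ := by
    rw [← Circle.exp_natCast_mul, mul_div_cancel₀ _ (Nat.cast_ne_zero.2 hn)]
  rw [this, hθ, inv_mul_cancel]

variable (m p) in
/-- The characters `d_{k,j} / d_{0,0}`, `j ≠ 0`, of the maximal torus of `SU(p)^m`. The common kernel
of these is `Δ(ℤ/p)`, so that they are coordinates on the maximal torus of the quotient. -/
noncomputable def torusChar [NeZero m] [NeZero p] :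
    diagTuples m p →* (Fin m × {j : Fin p // j ≠ 0} → Circle) where
  toFun A x := diagEntries m p A x.1 x.2 / diagEntries m p A 0 0
  map_one' := by
    ext x
    simp
  map_mul' A B := by
    funext x
    simp only [map_mul, Pi.mul_apply]
    exact mul_div_mul_comm _ _ _ _

theorem torusChar_surjective [NeZero m] [NeZero p] : Function.Surjective (torusChar m p) := by
  intro u
  obtain ⟨c, hc⟩ := Circle.exists_pow_mul_eq_one (NeZero.ne p)
    (∏ j : {j : Fin p // j ≠ 0}, u (0, j))
  let d : Fin m → Fin p → Circle := fun k j => if h : j ≠ 0 then c * u (k, ⟨j, h⟩) else 1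
  have hd (k : Fin m) (j : {j : Fin p // j ≠ 0}) :
      diagEntries m p (torusPoint d) k j = c * u (k, j) := by
    rw [diagEntries_torusPoint, Pi.mul_apply, Pi.mulSingle_eq_of_ne j.2, mul_one]
    exact dif_pos j.2
  -- The entries of the first matrix have product `1`, and `c` was chosen for this.
  have hd0 : diagEntries m p (torusPoint d) 0 0 = c := by
    have h := prod_diagEntries (torusPoint d) (0 : Fin m)
    rw [Fintype.prod_eq_mul_prod_subtype_ne _ 0] at h
    simp_rw [hd] at h
    rw [Finset.prod_mul_distrib, Finset.prod_const, Finset.card_univ] at h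
    have hcard : Fintype.card {j : Fin p // j ≠ 0} = p - 1 := by simp
    rw [hcard] at h
    have hp : c ^ p = c ^ (p - 1) * c := by
      rw [← pow_succ, Nat.sub_add_cancel (NeZero.pos p)]
    rw [hp, mul_right_comm, mul_comm] at hc
    exact mul_right_cancel (h.trans hc.symm)
  refine ⟨torusPoint d, funext fun x => ?_⟩
  change diagEntries m p (torusPoint d) x.1 x.2 / diagEntries m p (torusPoint d) 0 0 = _
  rw [hd, hd0, mul_div_cancel_left]

theorem torusChar_eq_one_iff [NeZero m] [NeZero p] {A : diagTuples m p} :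
    torusChar m p A = 1 ↔ A.1 ∈ diagCenter m p := by
  constructor
  · intro h
    set c := diagEntries m p A 0 0 with hc
    have h1 (k : Fin m) (j : {j : Fin p // j ≠ 0}) : diagEntries m p A k j = c :=
      div_eq_one.1 (congrFun h (k, j))
    have h0 (k : Fin m) : diagEntries m p A k 0 = c := by
      have hk := prod_diagEntries A k
      have hz := prod_diagEntries A 0
      rw [Fintype.prod_eq_mul_prod_subtype_ne _ 0] at hk hz
      simp_rw [h1] at hk hz
      exact mul_right_cancel (hk.trans hz.symm)
    refine ⟨c, fun k => ?_⟩
    rw [coe_eq_diagonal A.2, Matrix.scalar_apply]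
    congr 1
    ext j
    rw [← coe_diagEntries]
    by_cases hj : j = 0
    · rw [hj, h0]
    · rw [h1 k ⟨j, hj⟩]
  · rintro ⟨z, hz⟩
    have h (k j) : (diagEntries m p A k j : ℂ) = z := by
      rw [coe_diagEntries, hz, Matrix.scalar_apply, Matrix.diagonal_apply_eq]
    funext x
    exact div_eq_one.2 (Circle.coe_injective ((h _ _).trans (h _ _).symm))

theorem continuous_torusChar [NeZero m] [NeZero p] : Continuous (torusChar m p) := by
  have h (k : Fin m) (j : Fin p) : Continuous fun A => diagEntries m p A k j :=
    (continuous_apply j).comp ((continuous_apply k).comp continuous_diagEntries)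
  exact continuous_pi fun x => (h _ _).div' (h _ _)

/-- Two surjective homomorphisms from a compact group with the same kernel have isomorphic
Hausdorff images. -/
theorem nonempty_continuousMulEquiv_of_ker_eq {A B C : Type} [Group A] [Group B] [Group C]
    [TopologicalSpace A] [TopologicalSpace B] [TopologicalSpace C] [CompactSpace A] [T2Space B]
    [T2Space C] {f : A →* B} {g : A →* C} (hf : Continuous f) (hg : Continuous g)
    (hfs : Function.Surjective f) (hgs : Function.Surjective g) (h : f.ker = g.ker) :
    Nonempty (B ≃ₜ* C) := by
  let e : B ≃* C := (QuotientGroup.quotientKerEquivOfSurjective f hfs).symm.trans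
    ((QuotientGroup.quotientMulEquivOfEq h).trans
      (QuotientGroup.quotientKerEquivOfSurjective g hgs))
  have he (a : A) : e (f a) = g a := by
    have : (QuotientGroup.quotientKerEquivOfSurjective f hfs).symm (f a) = (a : A ⧸ f.ker) := by
      rw [MulEquiv.symm_apply_eq]
      rfl
    change QuotientGroup.quotientKerEquivOfSurjective g hgs (QuotientGroup.quotientMulEquivOfEq h
      ((QuotientGroup.quotientKerEquivOfSurjective f hfs).symm (f a))) = _
    rw [this]
    rfl
  have hcont : Continuous e := by
    rw [(hf.isClosedMap.isQuotientMap hf hfs).continuous_iff]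
    exact hg.congr fun a => (he a).symm
  have hcont' : Continuous e.symm := by
    rw [(hg.isClosedMap.isQuotientMap hg hgs).continuous_iff]
    exact hf.congr fun a => by rw [Function.comp_apply, ← he, e.symm_apply_apply]
  exact ⟨{ e with continuous_toFun := hcont, continuous_invFun := hcont' }⟩

variable (m p) in
theorem nonempty_maxTorus_equiv [NeZero m] [Fact p.Prime] :
    Nonempty (maxTorus m p ≃ₜ* (Fin ((p - 1) * m) → Circle)) := by
  have hcard : Fintype.card (Fin m × {j : Fin p // j ≠ 0}) = (p - 1) * m := by
    simp [mul_comm]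
  let r : (Fin m × {j : Fin p // j ≠ 0} → Circle) →* (Fin ((p - 1) * m) → Circle) :=
    { toFun := fun u i => u ((Fintype.equivFinOfCardEq hcard).symm i)
      map_one' := rfl
      map_mul' := fun _ _ => rfl }
  have hr : Function.Bijective r := (Equiv.arrowCongr (Fintype.equivFinOfCardEq hcard)
    (Equiv.refl Circle)).bijective
  have hrc : Continuous r := continuous_pi fun i => continuous_apply _
  refine nonempty_continuousMulEquiv_of_ker_eq (f := torusProj m p)
    (g := r.comp (torusChar m p)) continuous_torusProj (hrc.comp continuous_torusChar)
    torusProj_surjective (hr.2.comp torusChar_surjective) ?_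
  ext A
  rw [MonoidHom.mem_ker, MonoidHom.mem_ker, torusProj_eq_one_iff, ← torusChar_eq_one_iff,
    MonoidHom.comp_apply, map_eq_one_iff r hr.1]

end Torus

/-! ### The moduli space -/

section Connected

/-- Conjugating a path in the diagonal matrices joins `1` to any element of `SU(p)`. -/
theorem SU.joined_one {p : ℕ} [NeZero p] (A : SU p) : Joined 1 A := by
  obtain ⟨g, hg⟩ := SU.exists_conj_isDiag (NeZero.ne p) (fun _ : Unit => A)
    (fun _ _ => Commute.refl A)
  have hD : (fun _ : Fin 1 => g * A * g⁻¹) ∈ diagTuples 1 p := fun _ => hg ()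
  have h := (PathConnectedSpace.joined (1 : diagTuples 1 p) ⟨_, hD⟩).map
    (f := fun D : diagTuples 1 p => g⁻¹ * D.1 0 * g)
    ((continuous_const.mul ((continuous_apply (0 : Fin 1)).comp continuous_subtype_val)).mul
      continuous_const)
  convert h using 1
  · change 1 = g⁻¹ * 1 * g
    group
  · change A = g⁻¹ * (g * A * g⁻¹) * g
    group

instance {p : ℕ} [NeZero p] : PathConnectedSpace (SU p) :=
  ⟨⟨1⟩, fun A B => (SU.joined_one A).symm.trans (SU.joined_one B)⟩

instance {m p : ℕ} [NeZero p] : PathConnectedSpace (CentralProd m p) :=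
  QuotientGroup.mk_surjective.pathConnectedSpace QuotientGroup.continuous_mk

end Connected

section Tuples

variable {n m p : ℕ}

/-- A permutation of the diagonal entries is a conjugation. -/
theorem exists_conj_eq_permSU [NeZero p] (s : Equiv.Perm (Fin p)) :
    ∃ g : SU p, ∀ A : SU p, g * A * g⁻¹ = permSU s A := by
  let U : Matrix (Fin p) (Fin p) ℂ := (1 : Matrix (Fin p) (Fin p) ℂ).submatrix s.symm (Equiv.refl _)
  have hU : U ∈ Matrix.unitaryGroup (Fin p) ℂ := by
    rw [Matrix.mem_unitaryGroup_iff, Matrix.star_eq_conjTranspose, Matrix.conjTranspose_submatrix,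
      Matrix.conjTranspose_one]
    change Matrix.submatrix 1 s.symm (Equiv.refl _) * Matrix.submatrix 1 (Equiv.refl _) s.symm = 1
    rw [Matrix.submatrix_mul_equiv, Matrix.one_mul, Matrix.submatrix_one_equiv]
  obtain ⟨g, hg⟩ := SU.exists_conj_of_unitary (NeZero.ne p) hU
  refine ⟨g, fun A => Subtype.ext (hg A _ ?_)⟩
  change U * _ = (A : Matrix (Fin p) (Fin p) ℂ).submatrix s.symm s.symm * U
  rw [Matrix.submatrix_mul_equiv, Matrix.mul_one]
  have h := Matrix.submatrix_mul_equiv (1 : Matrix (Fin p) (Fin p) ℂ)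
    (A : Matrix (Fin p) (Fin p) ℂ) s.symm (Equiv.refl _) id
  rw [Matrix.one_mul] at h
  exact h

/-- Conjugate `n`-tuples in the maximal torus lie in one orbit of the Weyl group. -/
theorem mk_torusTuple_eq_iff [NeZero m] [Fact p.Prime] {t u : Fin n → maxTorus m p} :
    (⟦torusTuple t⟧ : RepZ n (CentralProd m p)) = ⟦torusTuple u⟧ ↔
      (⟦t⟧ : TorusQuot n m p) = ⟦u⟧ := by
  rw [RepZ.mk_eq_mk_iff, Quotient.eq]
  refine Iff.trans ?_ MulAction.mem_orbit_iff.symm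
  constructor
  · rintro ⟨g, hg⟩
    change ∀ i, (t i : CentralProd m p) = g * u i * g⁻¹ at hg
    obtain ⟨g, rfl⟩ := QuotientGroup.mk_surjective g
    choose A hA hAt using fun i => (t i).2
    choose B hB hBu using fun i => (u i).2
    -- Correcting the lifts `B i` by elements of the centre makes the lifted tuples conjugate.
    have hd (i : Fin n) : ∃ r, A i = g * (diagScalar m p r * B i) * g⁻¹ := by
      have h1 : ((g * B i * g⁻¹ : Fin m → SU p) : CentralProd m p) = A i := by
        refine Eq.trans ?_ ((hg i).symm.trans (hAt i).symm)
        rw [← hBu i]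
        rfl
      obtain ⟨r, hr⟩ := mem_diagCenter_iff.1 (QuotientGroup.eq.1 h1)
      refine ⟨r, ?_⟩
      rw [← mul_assoc g, ← (diagScalar_commute r g).eq, mul_assoc (diagScalar m p r),
        mul_assoc (diagScalar m p r), (diagScalar_commute r _).eq, ← hr, mul_inv_cancel_left]
    choose r hr using hd
    have hrB (i) (k : Fin m) :
        ((diagScalar m p (r i) * B i) k : Matrix (Fin p) (Fin p) ℂ).IsDiag := by
      have : diagScalar m p (r i) ∈ diagTuples m p := fun _ => Matrix.isDiag_diagonal _
      exact mul_mem this (hB i) k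
    choose s hs using fun k => SU.exists_perm_of_conj_isDiag (fun i => A i k)
      (fun i => (diagScalar m p (r i) * B i) k) (fun i => hA i k) (fun i => hrB i k) (g k)
      (fun i => congrFun (hr i) k)
    refine ⟨s, funext fun i => Subtype.ext ?_⟩
    rw [← hAt i]
    have h1 : A i = permTuple s (diagScalar m p (r i) * B i) := funext fun k => hs k i
    have h2 : QuotientGroup.mk' (diagCenter m p) (diagScalar m p (r i) * B i) = u i := by
      have h3 : QuotientGroup.mk' (diagCenter m p) (diagScalar m p (r i)) = 1 :=
        (QuotientGroup.eq_one_iff _).2 (diagScalar_mem _)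
      rw [← hBu i, map_mul, h3, one_mul]
    change permG s (u i) = _
    rw [h1, ← h2]
    rfl
  · rintro ⟨s, rfl⟩
    choose g hg using fun k => exists_conj_eq_permSU (s k)
    refine ⟨(g : Fin m → SU p), fun i => ?_⟩
    change permG s (u i) = _ * (u i : CentralProd m p) * _
    obtain ⟨A, hA⟩ := QuotientGroup.mk_surjective (u i : CentralProd m p)
    rw [← hA]
    exact congrArg (QuotientGroup.mk (s := diagCenter m p))
      (funext fun k => (hg k (A k)).symm : permTuple s A = g * A * g⁻¹)

theorem not_nondegenerate_torusTuple [NeZero m] [Fact p.Prime] (t : Fin n → maxTorus m p) :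
    ¬ (centralProdPairing m p).Nondegenerate (torusTuple t) := by
  rintro ⟨i, j, h⟩
  obtain ⟨A, hA, hAt⟩ := (t i).2
  obtain ⟨B, hB, hBt⟩ := (t j).2
  refine h ?_
  change commutatorForm (t i : CentralProd m p) (t j) = 0
  rw [← hAt, ← hBt]
  exact commutatorForm_mk (twistedCommute_zero.2 (diagTuples_commute hA hB))

/-- A tuple with commuting lifts is conjugate to one in the maximal torus. -/
theorem exists_mk_torusTuple_eq [NeZero m] [Fact p.Prime] {x : HomZ n (CentralProd m p)}
    (hx : ¬ (centralProdPairing m p).Nondegenerate x) :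
    ∃ t : Fin n → maxTorus m p, (⟦torusTuple t⟧ : RepZ n (CentralProd m p)) = ⟦x⟧ := by
  choose A hA using fun i => QuotientGroup.mk_surjective (x.1 i)
  have hcomm (i j : Fin n) : Commute (A i) (A j) := by
    have h := x.2 i j
    rw [← hA i, ← hA j] at h
    obtain ⟨t, ht⟩ := commute_mk_iff.1 h
    have h0 : commutatorForm (x.1 i) (x.1 j) = 0 := by
      by_contra hne
      exact hx ⟨i, j, hne⟩
    rw [← hA i, ← hA j, commutatorForm_mk ht] at h0
    subst h0
    exact twistedCommute_zero.1 ht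
  choose g hg using fun k => SU.exists_conj_isDiag (NeZero.ne p) (fun i => A i k)
    (fun i j => congrFun (hcomm i j) k)
  refine ⟨fun i => ⟨_, g * A i * g⁻¹, fun k => hg k i, rfl⟩, ?_⟩
  refine RepZ.mk_eq_mk_iff.2 ⟨(g : Fin m → SU p), fun i => ?_⟩
  rw [← hA i]
  rfl

end Tuples

section ConjugationTopology

variable {n : ℕ} {G : Type} [Group G]

/-- The conjugate of a commuting tuple by an element of `G`. -/
def HomZ.conj (g : G) (x : HomZ n G) : HomZ n G := ConjAct.toConjAct g • x

theorem HomZ.mk_eq_mk_iff_exists_conj {x y : HomZ n G} :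
    (⟦x⟧ : RepZ n G) = ⟦y⟧ ↔ ∃ g : G, HomZ.conj g y = x :=
  Quotient.eq.trans MulAction.mem_orbit_iff

variable [TopologicalSpace G]

theorem HomZ.continuous_conj [IsTopologicalGroup G] :
    Continuous fun q : G × HomZ n G => HomZ.conj q.1 q.2 := by
  refine continuous_induced_rng.2 (continuous_pi fun i => ?_)
  have h : Continuous fun q : G × HomZ n G => q.2.1 i :=
    (continuous_apply i).comp (continuous_subtype_val.comp continuous_snd)
  exact (continuous_fst.mul h).mul continuous_fst.inv

/-- The image in `Rep(ℤⁿ, G)` of a compact set of tuples is closed: its preimage in `Hom(ℤⁿ, G)` is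
the image of a compact set under conjugation. -/
theorem RepZ.isClosed_image_of_isCompact [IsTopologicalGroup G] [CompactSpace G] [T2Space G]
    {C : Set (HomZ n G)} (hC : IsCompact C) :
    IsClosed ((fun x => (⟦x⟧ : RepZ n G)) '' C) := by
  rw [← isQuotientMap_quotient_mk'.isClosed_preimage]
  have : (Quotient.mk (MulAction.orbitRel (ConjAct G) (HomZ n G)) ⁻¹'
      ((fun x => (⟦x⟧ : RepZ n G)) '' C) : Set (HomZ n G)) =
      (fun q : G × HomZ n G => HomZ.conj q.1 q.2) '' (Set.univ ×ˢ C) := by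
    ext x
    constructor
    · rintro ⟨y, hy, hyx⟩
      obtain ⟨g, hg⟩ := HomZ.mk_eq_mk_iff_exists_conj.1 hyx.symm
      exact ⟨(g, y), ⟨trivial, hy⟩, hg⟩
    · rintro ⟨⟨g, y⟩, ⟨-, hy⟩, rfl⟩
      exact ⟨y, hy, (HomZ.mk_eq_mk_iff_exists_conj.2 ⟨g, rfl⟩).symm⟩
  refine Eq.mpr (congrArg IsClosed this) ?_
  exact ((isCompact_univ.prod hC).image HomZ.continuous_conj).isClosed

theorem RepZ.isClosed_singleton [IsTopologicalGroup G] [CompactSpace G] [T2Space G]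
    (o : RepZ n G) : IsClosed ({o} : Set (RepZ n G)) := by
  obtain ⟨x, rfl⟩ := Quotient.exists_rep o
  simpa using RepZ.isClosed_image_of_isCompact (isCompact_singleton (x := x))

/-- A conjugation orbit that is an isolated point of `Rep(ℤⁿ, G)` is a path component of
`Hom(ℤⁿ, G)`. -/
theorem HomZ.pathComponent_eq_orbit [IsTopologicalGroup G] [CompactSpace G] [T2Space G]
    [PathConnectedSpace G] {x : HomZ n G} (hx : IsOpen ({⟦x⟧} : Set (RepZ n G))) :
    pathComponent x = MulAction.orbit (ConjAct G) x := by
  have horb : MulAction.orbit (ConjAct G) x = Quotient.mk _ ⁻¹' ({⟦x⟧} : Set (RepZ n G)) := by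
    ext y
    exact (Quotient.eq (r := MulAction.orbitRel (ConjAct G) (HomZ n G))).symm
  apply Set.Subset.antisymm
  · have hclopen : IsClopen (MulAction.orbit (ConjAct G) x) := by
      rw [horb]
      exact ⟨(RepZ.isClosed_singleton _).preimage continuous_quotient_mk',
        hx.preimage continuous_quotient_mk'⟩
    exact (pathComponent_subset_component x).trans
      (hclopen.connectedComponent_subset (MulAction.mem_orbit_self x))
  · rintro _ ⟨g, rfl⟩
    have h := (PathConnectedSpace.joined (1 : G) (ConjAct.ofConjAct g)).map
      (f := fun g => HomZ.conj g x)
      (HomZ.continuous_conj.comp (continuous_id.prodMk continuous_const))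
    have h1 : HomZ.conj (1 : G) x = x := one_smul (ConjAct G) x
    rw [h1] at h
    exact h

end ConjugationTopology

section Components

/-- The path components of the disjoint union of a path connected space and `r` points. -/
theorem card_zerothHomotopy_of_homeomorph {W Z : Type} [TopologicalSpace W] [TopologicalSpace Z]
    [PathConnectedSpace W] {r : ℕ} (Φ : W ⊕ Fin r ≃ₜ Z) :
    Nat.card (ZerothHomotopy Z) = r + 1 := by
  obtain ⟨w₀⟩ := PathConnectedSpace.nonempty (X := W)
  let _ : TopologicalSpace (Option (Fin r)) := ⊥
  have : DiscreteTopology (Option (Fin r)) := ⟨rfl⟩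
  let F : Option (Fin r) → ZerothHomotopy Z := fun o =>
    .mk (Φ (o.elim (Sum.inl w₀) Sum.inr))
  -- Collapsing `W` to a point gives a map to a discrete space, constant along paths.
  let c : W ⊕ Fin r → Option (Fin r) := Sum.elim (fun _ => none) some
  have hc : Continuous c := continuous_const.sumElim continuous_of_discreteTopology
  have hF : Function.Bijective F := by
    constructor
    · intro a b hab
      obtain ⟨γ⟩ : Joined (Φ (a.elim (Sum.inl w₀) Sum.inr)) (Φ (b.elim (Sum.inl w₀) Sum.inr)) :=
        Quotient.exact hab
      have h := PreconnectedSpace.constant (inferInstance : PreconnectedSpace unitInterval)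
        (f := fun s => c (Φ.symm (γ s))) (hc.comp (Φ.symm.continuous.comp γ.continuous))
        (x := 0) (y := 1)
      simp only [γ.source, γ.target, Φ.symm_apply_apply] at h
      have hca (o : Option (Fin r)) : c (o.elim (Sum.inl w₀) Sum.inr) = o := by
        cases o <;> rfl
      rwa [hca, hca] at h
    · intro z
      obtain ⟨z, rfl⟩ := ZerothHomotopy.mk_surjective z
      obtain ⟨w | i, rfl⟩ := Φ.surjective z
      · exact ⟨none, Quotient.sound ((PathConnectedSpace.joined w₀ w).map
          (Φ.continuous.comp continuous_inl))⟩
      · exact ⟨some i, rfl⟩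
  rw [← Nat.card_eq_of_bijective F hF]
  simp

end Components

section Moduli

variable {n m p : ℕ}

theorem continuous_torusTuple :
    Continuous (torusTuple : (Fin n → maxTorus m p) → HomZ n (CentralProd m p)) :=
  continuous_induced_rng.2 (continuous_pi fun i =>
    continuous_subtype_val.comp (continuous_apply i))

/-- A tuple conjugate to one in the maximal torus lies in the component of the trivial tuple. -/
theorem mem_pathComponent_trivial [NeZero p] {x : HomZ n (CentralProd m p)}
    {t : Fin n → maxTorus m p} (h : (⟦torusTuple t⟧ : RepZ n (CentralProd m p)) = ⟦x⟧) :
    x ∈ pathComponent (HomZ.trivial n (CentralProd m p)) := by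
  obtain ⟨g, rfl⟩ := HomZ.mk_eq_mk_iff_exists_conj.1 h.symm
  have h := (PathConnectedSpace.joined (1 : Fin n → maxTorus m p) t).map
    (f := fun t => HomZ.conj g (torusTuple t))
    (HomZ.continuous_conj.comp (continuous_const.prodMk continuous_torusTuple))
  have h1 : HomZ.conj g (torusTuple (1 : Fin n → maxTorus m p)) = HomZ.trivial n _ := by
    refine Subtype.ext (funext fun i => ?_)
    change g * 1 * g⁻¹ = 1
    group
  rw [h1] at h
  exact h

/-- The inclusion `Tⁿ ⊆ Hom(ℤⁿ, G)` on orbit spaces. -/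
def torusQuotMap [NeZero m] [Fact p.Prime] : TorusQuot n m p → RepZ n (CentralProd m p) :=
  Quotient.lift (fun t => ⟦torusTuple t⟧) fun _ _ h =>
    mk_torusTuple_eq_iff.2 (Quotient.sound h)

variable (n m p) in
/-- The moduli space is the disjoint union of the orbit space of the torus and of the finitely many
nondegenerate classes. Both pieces are closed by compactness, hence also open. -/
theorem exists_homeomorph [NeZero m] [Fact p.Prime] :
    ∃ Φ : TorusQuot n m p ⊕ Fin (Nat.card ((centralProdPairing m p).nondegenerateClasses n)) ≃ₜ
      RepZ n (CentralProd m p), ∀ t : Fin n → maxTorus m p, Φ (Sum.inl ⟦t⟧) = ⟦torusTuple t⟧ := by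
  have : Finite ((centralProdPairing m p).nondegenerateClasses n) := finite_nondegenerateClasses n
  let e := (Finite.equivFin ((centralProdPairing m p).nondegenerateClasses n)).symm
  let f : TorusQuot n m p ⊕ Fin (Nat.card ((centralProdPairing m p).nondegenerateClasses n)) →
      RepZ n (CentralProd m p) := Sum.elim torusQuotMap fun i => e i
  have hcont : Continuous (torusQuotMap : TorusQuot n m p → RepZ n (CentralProd m p)) :=
    (continuous_quotient_mk'.comp continuous_torusTuple).quotient_lift _
  have hdisj (w : TorusQuot n m p) (i) : torusQuotMap w ≠ (e i : RepZ n (CentralProd m p)) := by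
    obtain ⟨t, rfl⟩ := Quotient.exists_rep w
    obtain ⟨x, hx, hnd⟩ := (e i).2
    rw [← hx]
    intro h
    exact not_nondegenerate_torusTuple t
      ((centralProdPairing m p).nondegenerate_of_mk_eq h hnd)
  have hinj : Function.Injective f := by
    refine Function.Injective.sumElim ?_ (Subtype.val_injective.comp e.injective) hdisj
    intro v w h
    obtain ⟨t, rfl⟩ := Quotient.exists_rep v
    obtain ⟨u, rfl⟩ := Quotient.exists_rep w
    exact mk_torusTuple_eq_iff.1 h
  have hsurj : Function.Surjective f := by
    intro o
    obtain ⟨x, rfl⟩ := Quotient.exists_rep o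
    by_cases hx : (centralProdPairing m p).Nondegenerate x
    · refine ⟨Sum.inr (e.symm ⟨_, x, rfl, hx⟩), ?_⟩
      exact congrArg Subtype.val (e.apply_symm_apply _)
    · obtain ⟨t, ht⟩ := exists_mk_torusTuple_eq hx
      exact ⟨Sum.inl ⟦t⟧, ht⟩
  have hclosed : IsClosedMap f := by
    refine IsClosedMap.sumElim ?_ ?_
    · intro C hC
      have hpre : IsCompact (Quotient.mk _ ⁻¹' C : Set (Fin n → maxTorus m p)) :=
        (hC.preimage continuous_quotient_mk').isCompact
      have h := RepZ.isClosed_image_of_isCompact (hpre.image continuous_torusTuple)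
      convert h using 1
      ext o
      constructor
      · rintro ⟨w, hw, rfl⟩
        obtain ⟨t, rfl⟩ := Quotient.exists_rep w
        exact ⟨_, ⟨t, hw, rfl⟩, rfl⟩
      · rintro ⟨_, ⟨t, ht, rfl⟩, rfl⟩
        exact ⟨_, ht, rfl⟩
    · intro C _
      have : T1Space (RepZ n (CentralProd m p)) := ⟨RepZ.isClosed_singleton⟩
      exact (Set.toFinite _).isClosed
  exact ⟨(Equiv.ofBijective f ⟨hinj, hsurj⟩).toHomeomorphOfContinuousClosed
    (hcont.sumElim continuous_of_discreteTopology) hclosed, fun t => rfl⟩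

end Moduli

theorem theorem1p2 (n m p : ℕ) (hn : 1 ≤ n) (hm : 1 ≤ m) (hp : p.Prime) :
    -- the maximal torus is `(S¹)^{(p-1)m}`
    Nonempty (maxTorus m p ≃ₜ* (Fin ((p - 1) * m) → Circle)) ∧
    -- the number of path components of the moduli space
    (Nat.card (ZerothHomotopy (RepZ n (CentralProd m p))) : ℚ) = numComp n m p ∧
    -- the homeomorphism; on the first summand it is induced by the inclusion `Tⁿ ⊆ Hom(ℤⁿ, G)`
    (∃ r : ℕ, (r : ℚ) = numComp n m p - 1 ∧
      ∃ Φ : TorusQuot n m p ⊕ Fin r ≃ₜ RepZ n (CentralProd m p),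
        ∀ t : Fin n → maxTorus m p, Φ (Sum.inl ⟦t⟧) = ⟦torusTuple t⟧) ∧
    -- a component not containing `(1, …, 1)` is one conjugation orbit and gives an isolated point
    (∀ x : HomZ n (CentralProd m p), x ∉ pathComponent (HomZ.trivial n (CentralProd m p)) →
      pathComponent x = MulAction.orbit (ConjAct (CentralProd m p)) x ∧
      IsOpen ({⟦x⟧} : Set (RepZ n (CentralProd m p)))) := by
  have : Fact p.Prime := ⟨hp⟩
  have : NeZero m := ⟨Nat.one_le_iff_ne_zero.1 hm⟩
  obtain ⟨Φ, hΦ⟩ := exists_homeomorph n m p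
  have hcard := card_nondegenerateClasses (m := m) (p := p) hn
  have : PathConnectedSpace (TorusQuot n m p) :=
    Quotient.mk_surjective.pathConnectedSpace continuous_quotient_mk'
  refine ⟨nonempty_maxTorus_equiv m p, ?_, ⟨_, hcard, Φ, hΦ⟩, fun x hx => ?_⟩
  · rw [card_zerothHomotopy_of_homeomorph Φ, Nat.cast_add, hcard, Nat.cast_one, sub_add_cancel]
  · have hopen : IsOpen ({⟦x⟧} : Set (RepZ n (CentralProd m p))) := by
      obtain ⟨w | i, hw⟩ := Φ.surjective ⟦x⟧
      · obtain ⟨t, rfl⟩ := Quotient.exists_rep w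
        exact absurd (mem_pathComponent_trivial ((hΦ t).symm.trans hw)) hx
      · rw [← hw, ← Set.image_singleton, Φ.isOpen_image, ← Set.image_singleton]
        exact isOpenMap_inr _ (isOpen_discrete _)
    exact ⟨HomZ.pathComponent_eq_orbit hopen, hopen⟩
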